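/- Let $M$ be a connected (Hausdorff, second countable) smooth manifold of dimension $m\ge 2$ with a smooth pseudo-Riemannian metric $g$ (of any signature), and let $P_0\in M$. A homothety is a diffeomorphism $\Phi$ of $M$ with $\Phi^*g=\lambda(\Phi)^2g$ for a constant $\lambda(\Phi)>0$; $\lambda$ is a character of the group of homotheties, whose kernel is the isometry group. Let $\mathcal H$ be a subgroup of the group of homotheties (for instance a connected Lie subgroup, or the full group) that acts transitively on $M$ and on which $\lambda$ is non-trivial, and let $\mathcal I=\mathcal H\cap\ker\lambda$. A Weyl scalar invariant of order $\ell$ is a real linear combination of complete contractions, by means of $g^{-1}$, of tensors $\nabla^{k_1}R\otimes\dots\otimes\nabla^{k_r}R$ with $r\ge1$ and $\sum_a(k_a+2)=\ell$, where $R$ is the curvature tensor and $\nabla$ the Levi-Civita connection. Suppose that $M$ is not VSI, i.e. that some Weyl scalar invariant does not vanish identically. For a Weyl scalar invariant $\mathcal R$ of order $\ell$ that vanishes nowhere on $M$ put $$\mu_{\mathcal R}(P)=\left|\frac{\mathcal R(P_0)}{\mathcal R(P)}\right|^{1/\ell},\qquad M_c^{\mathcal R}=\{P\in M:\mu_{\mathcal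 R}(P)=c\}.$$ Then: 1. For every nowhere vanishing Weyl scalar invariant $\mathcal R$ and every $c>0$, the level set $M_c^{\mathcal R}$ is a non-empty embedded smooth submanifold of $M$ of codimension $1$, it is preserved by $\mathcal I$, and $\mathcal I$ acts transitively on it. Moreover $M_c^{\mathcal R}=M_c^{\mathcal R'}$ for any two nowhere vanishing Weyl scalar invariants $\mathcal R,\mathcal R'$ (possibly of different orders) and all $c$. In particular $M$ has cohomogeneity one: every orbit of the full isometry group of $M$ is an embedded submanifold of codimension $1$. 2. If $g$ is Riemannian, then there is a constant $\kappa>0$ such that for every nowhere vanishing Weyl scalar invariant $\mathcal R$ and all $c,d>0$ $$\operatorname{dist}(M_c^{\mathcal R},M_d^{\mathcal R})=\kappa\,|c-d|,$$ where $\operatorname{dist}$ is the infimum of the Riemannian distances between points of the two sets. Furthermore $M$, with its Riemannian distance, is not a complete metric space. -/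

import Mathlib

open Set Filter Topology Manifold Bundle
open scoped ContDiff ENNReal

noncomputable section

/-! ### Tensor calculus in coordinates

A field of bilinear forms on (an open part of) `ℝᵐ` is given by its component matrix `G x`, a
covariant tensor field of rank `n` by its components `T x I`, `I : Fin n → Fin m`. -/

/-- The partial derivative `∂ᵢ f`. -/
def partialDeriv {m : ℕ} (i : Fin m) (f : EuclideanSpace ℝ (Fin m) → ℝ)
    (x : EuclideanSpace ℝ (Fin m)) : ℝ :=
  fderiv ℝ f x (EuclideanSpace.single i 1)

/-- The Christoffel symbols
`Γᵏᵢⱼ = ½ gᵏˡ (∂ᵢ gⱼₗ + ∂ⱼ gᵢₗ - ∂ₗ gᵢⱼ)` of the Levi-Civita connection. -/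
def christoffel {m : ℕ} (G : EuclideanSpace ℝ (Fin m) → Matrix (Fin m) (Fin m) ℝ)
    (k i j : Fin m) (x : EuclideanSpace ℝ (Fin m)) : ℝ :=
  (1 / 2 : ℝ) * ∑ l, (G x)⁻¹ k l *
    (partialDeriv i (fun y => G y j l) x + partialDeriv j (fun y => G y i l) x
      - partialDeriv l (fun y => G y i j) x)

/-- The curvature tensor `Rᵢⱼₖₗ = g(R(∂ᵢ,∂ⱼ)∂ₖ, ∂ₗ)`, where
`R(∂ᵢ,∂ⱼ)∂ₖ = ∇ᵢ∇ⱼ∂ₖ - ∇ⱼ∇ᵢ∂ₖ`. -/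
def curvatureTensor {m : ℕ} (G : EuclideanSpace ℝ (Fin m) → Matrix (Fin m) (Fin m) ℝ)
    (x : EuclideanSpace ℝ (Fin m)) (I : Fin 4 → Fin m) : ℝ :=
  ∑ a, G x a (I 3) *
    (partialDeriv (I 0) (christoffel G a (I 1) (I 2)) x
      - partialDeriv (I 1) (christoffel G a (I 0) (I 2)) x
      + ∑ b, (christoffel G a (I 0) b x * christoffel G b (I 1) (I 2) x
          - christoffel G a (I 1) b x * christoffel G b (I 0) (I 2) x))

/-- The covariant derivative of a covariant tensor field; the new index is the last one:
`T_{i₁…iₙ;j} = ∂ⱼ T_{i₁…iₙ} - ∑ₛ Γᵇ_{j iₛ} T_{i₁…b…iₙ}`. -/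
def covariantDeriv {m n : ℕ} (G : EuclideanSpace ℝ (Fin m) → Matrix (Fin m) (Fin m) ℝ)
    (T : EuclideanSpace ℝ (Fin m) → (Fin n → Fin m) → ℝ)
    (x : EuclideanSpace ℝ (Fin m)) (I : Fin (n + 1) → Fin m) : ℝ :=
  partialDeriv (I (Fin.last n)) (fun y => T y (Fin.init I)) x
    - ∑ s : Fin n, ∑ b, christoffel G b (I (Fin.last n)) (Fin.init I s) x
        * T x (Function.update (Fin.init I) s b)

/-- The `k`-th covariant derivative `∇ᵏR` of the curvature tensor. -/
def nablaCurvature {m : ℕ} (G : EuclideanSpace ℝ (Fin m) → Matrix (Fin m) (Fin m) ℝ) :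
    (k : ℕ) → EuclideanSpace ℝ (Fin m) → (Fin (4 + k) → Fin m) → ℝ
  | 0 => curvatureTensor G
  | k + 1 => covariantDeriv G (nablaCurvature G k)

/-- The complete contraction of `∇^{k₀}R ⊗ ⋯ ⊗ ∇^{kᵣ₋₁}R`. The index slots of this tensor are the
pairs `⟨a, s⟩` with `a` a factor and `s` one of its `4 + kₐ` slots; `σ` arranges all of them in
pairs `{σ (t, 0), σ (t, 1)}`, and each pair is contracted by the inverse metric. -/
def completeContraction {m r N : ℕ}
    (G : EuclideanSpace ℝ (Fin m) → Matrix (Fin m) (Fin m) ℝ) (k : Fin r → ℕ)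
    (σ : Fin N × Fin 2 ≃ (Σ a : Fin r, Fin (4 + k a))) (x : EuclideanSpace ℝ (Fin m)) : ℝ :=
  ∑ J : (Σ a : Fin r, Fin (4 + k a)) → Fin m,
    (∏ t : Fin N, (G x)⁻¹ (J (σ (t, 0))) (J (σ (t, 1))))
      * ∏ a : Fin r, nablaCurvature G (k a) x (fun s => J ⟨a, s⟩)

section Manifolds

variable {m : ℕ} {M : Type*} [TopologicalSpace M] [ChartedSpace (EuclideanSpace ℝ (Fin m)) M]

/-- `S` is an embedded smooth submanifold of codimension `k`: near each of its points there is a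
smooth chart in which `S` is given by the vanishing of the last `k` coordinates. -/
def IsSmoothSubmanifold (m : ℕ) {M : Type*} [TopologicalSpace M]
    [ChartedSpace (EuclideanSpace ℝ (Fin m)) M] (k : ℕ) (S : Set M) : Prop :=
  k ≤ m ∧ ∀ p ∈ S, ∃ e ∈ IsManifold.maximalAtlas (𝓡 m) ∞ M, p ∈ e.source ∧
    ∀ q ∈ e.source, q ∈ S ↔ ∀ i : Fin m, m ≤ (i : ℕ) + k → e q i = 0

/-- A smooth pseudo-Riemannian metric on an `m`-dimensional manifold. -/
structure PseudoRiemannianMetric (m : ℕ) (M : Type*) [TopologicalSpace M]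
    [ChartedSpace (EuclideanSpace ℝ (Fin m)) M] [IsManifold (𝓡 m) ∞ M] where
  val (p : M) : TangentSpace (𝓡 m) p →L[ℝ] TangentSpace (𝓡 m) p →L[ℝ] ℝ
  symm (p : M) (v w : TangentSpace (𝓡 m) p) : val p v w = val p w v
  nondegenerate (p : M) (v : TangentSpace (𝓡 m) p) : (∀ w, val p v w = 0) → v = 0
  contMDiff : ContMDiff (𝓡 m) ((𝓡 m).prod 𝓘(ℝ, EuclideanSpace ℝ (Fin m) →L[ℝ]
      EuclideanSpace ℝ (Fin m) →L[ℝ] ℝ)) ∞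
    (fun p => TotalSpace.mk' (EuclideanSpace ℝ (Fin m) →L[ℝ] EuclideanSpace ℝ (Fin m) →L[ℝ] ℝ)
      (E := fun p : M => TangentSpace (𝓡 m) p →L[ℝ] TangentSpace (𝓡 m) p →L[ℝ] ℝ) p (val p))

variable [IsManifold (𝓡 m) ∞ M]

namespace PseudoRiemannianMetric

/-- `T^* g = c² g`. -/
def PullsBackTo (g : PseudoRiemannianMetric m M) (T : Equiv.Perm M) (c : ℝ) : Prop :=
  ∀ (p : M) (v w : TangentSpace (𝓡 m) p),
    g.val (T p) (mfderiv (𝓡 m) (𝓡 m) T p v) (mfderiv (𝓡 m) (𝓡 m) T p w) = c ^ 2 * g.val p v w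

theorem val_comp (g : PseudoRiemannianMetric m M) {S T : Equiv.Perm M} {c : ℝ}
    (hS : ContMDiff (𝓡 m) (𝓡 m) ∞ S) (hT : ContMDiff (𝓡 m) (𝓡 m) ∞ T)
    (h : g.PullsBackTo S c) (p : M) (v w : TangentSpace (𝓡 m) p) :
    g.val ((S * T) p) (mfderiv (𝓡 m) (𝓡 m) (S * T : Equiv.Perm M) p v)
      (mfderiv (𝓡 m) (𝓡 m) (S * T : Equiv.Perm M) p w)
      = c ^ 2 * g.val (T p) (mfderiv (𝓡 m) (𝓡 m) T p v) (mfderiv (𝓡 m) (𝓡 m) T p w) := by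
  have e : mfderiv (𝓡 m) (𝓡 m) (S * T : Equiv.Perm M) p
      = (mfderiv (𝓡 m) (𝓡 m) S (T p)).comp (mfderiv (𝓡 m) (𝓡 m) T p) :=
    mfderiv_comp p (hS.mdifferentiable (by simp) _) (hT.mdifferentiable (by simp) _)
  rw [e]
  exact h (T p) _ _

theorem PullsBackTo.mul {g : PseudoRiemannianMetric m M} {S T : Equiv.Perm M} {c d : ℝ}
    (hS : ContMDiff (𝓡 m) (𝓡 m) ∞ S) (hT : ContMDiff (𝓡 m) (𝓡 m) ∞ T)
    (h : g.PullsBackTo S c) (k : g.PullsBackTo T d) : g.PullsBackTo (S * T) (c * d) := by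
  intro p v w
  rw [g.val_comp hS hT h p v w, mul_pow, mul_assoc]
  exact congrArg (fun t => c ^ 2 * t) (k p v w)

theorem PullsBackTo.one (g : PseudoRiemannianMetric m M) : g.PullsBackTo 1 1 := by
  intro p v w
  have e : mfderiv (𝓡 m) (𝓡 m) (1 : Equiv.Perm M) p
      = ContinuousLinearMap.id ℝ (TangentSpace (𝓡 m) p) := mfderiv_id
  rw [e]
  exact (by simp : g.val p v w = 1 ^ 2 * g.val p v w)

theorem PullsBackTo.inv {g : PseudoRiemannianMetric m M} {T : Equiv.Perm M} {c : ℝ} (hc : 0 < c)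
    (hT : ContMDiff (𝓡 m) (𝓡 m) ∞ T) (hT' : ContMDiff (𝓡 m) (𝓡 m) ∞ (T⁻¹ : Equiv.Perm M))
    (h : g.PullsBackTo T c) : g.PullsBackTo T⁻¹ c⁻¹ := by
  intro p v w
  have h1 := g.val_comp hT hT' h p v w
  rw [mul_inv_cancel] at h1
  have h2 := (PullsBackTo.one g p v w).symm.trans h1
  rw [one_pow, one_mul] at h2
  rw [h2, ← mul_assoc, ← mul_pow, inv_mul_cancel₀ hc.ne', one_pow, one_mul]

/-- The group of homotheties: the diffeomorphisms `T` of `M` with `T^* g = c² g` for a constant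
`c > 0`. -/
def homothetyGroup (g : PseudoRiemannianMetric m M) : Subgroup (Equiv.Perm M) where
  carrier := {T | ContMDiff (𝓡 m) (𝓡 m) ∞ T ∧ ContMDiff (𝓡 m) (𝓡 m) ∞ (T⁻¹ : Equiv.Perm M) ∧
    ∃ c : ℝ, 0 < c ∧ g.PullsBackTo T c}
  mul_mem' := by
    rintro S T ⟨hS, hS', c, hc, h⟩ ⟨hT, hT', d, hd, k⟩
    refine ⟨hS.comp hT, ?_, c * d, mul_pos hc hd, h.mul hS hT k⟩
    rw [mul_inv_rev]
    exact hT'.comp hS'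
  one_mem' := ⟨contMDiff_id, by rw [inv_one]; exact contMDiff_id, 1, one_pos, PullsBackTo.one g⟩
  inv_mem' := by
    rintro T ⟨hT, hT', c, hc, h⟩
    exact ⟨hT', by rwa [inv_inv], c⁻¹, inv_pos.2 hc, h.inv hc hT hT'⟩

/-- The homothety constant `λ(T) > 0` of a homothety `T`: `T^* g = λ(T)² g`. -/
def homothetyConstant (g : PseudoRiemannianMetric m M) (T : g.homothetyGroup) : ℝ :=
  T.2.2.2.choose

theorem homothetyConstant_pos (g : PseudoRiemannianMetric m M) (T : g.homothetyGroup) :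
    0 < g.homothetyConstant T :=
  T.2.2.2.choose_spec.1

theorem pullsBackTo_homothetyConstant (g : PseudoRiemannianMetric m M) (T : g.homothetyGroup) :
    g.PullsBackTo T (g.homothetyConstant T) :=
  T.2.2.2.choose_spec.2

theorem exists_val_ne_zero (g : PseudoRiemannianMetric m M) (hm : 2 ≤ m) (p : M) :
    ∃ v w : TangentSpace (𝓡 m) p, g.val p v w ≠ 0 := by
  by_contra! h
  have h0 := g.nondegenerate p (EuclideanSpace.single (⟨0, by omega⟩ : Fin m) (1 : ℝ)) (h _)
  have h1 := congrArg (fun v : EuclideanSpace ℝ (Fin m) => v ⟨0, by omega⟩) h0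
  have h2 : (EuclideanSpace.single (⟨0, by omega⟩ : Fin m) (1 : ℝ) : EuclideanSpace ℝ (Fin m))
      ⟨0, by omega⟩ = 0 := h1
  simp at h2

/-- The homothety constant is unique. -/
theorem homothetyConstant_eq [Nonempty M] (g : PseudoRiemannianMetric m M) (hm : 2 ≤ m)
    {T : g.homothetyGroup} {c : ℝ} (hc : 0 < c) (h : g.PullsBackTo T c) :
    g.homothetyConstant T = c := by
  obtain ⟨p⟩ := ‹Nonempty M›
  obtain ⟨v, w, hvw⟩ := g.exists_val_ne_zero hm p
  have h1 := (g.pullsBackTo_homothetyConstant T p v w).symm.trans (h p v w)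
  exact (pow_left_inj₀ (g.homothetyConstant_pos T).le hc.le two_ne_zero).1
    (mul_right_cancel₀ hvw h1)

/-- The homothety character `λ`, a homomorphism from the homotheties to the positive reals. Its
kernel consists of the isometries. -/
def homothetyCharacter [Nonempty M] (g : PseudoRiemannianMetric m M) (hm : 2 ≤ m) :
    g.homothetyGroup →* ℝ where
  toFun := g.homothetyConstant
  map_one' := g.homothetyConstant_eq hm one_pos (PullsBackTo.one g)
  map_mul' S T := g.homothetyConstant_eq hm
    (mul_pos (g.homothetyConstant_pos S) (g.homothetyConstant_pos T))
    ((g.pullsBackTo_homothetyConstant S).mul S.2.1 T.2.1 (g.pullsBackTo_homothetyConstant T))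

/-- The components `gᵢⱼ(x)` of the metric with respect to the coordinate vector fields of the
chart `e`, at the point with coordinates `x`. -/
def inChart (g : PseudoRiemannianMetric m M) (e : OpenPartialHomeomorph M (EuclideanSpace ℝ (Fin m)))
    (x : EuclideanSpace ℝ (Fin m)) : Matrix (Fin m) (Fin m) ℝ :=
  fun i j => g.val (e.symm x)
    (mfderiv (𝓡 m) (𝓡 m) e.symm x (EuclideanSpace.single i (1 : ℝ)))
    (mfderiv (𝓡 m) (𝓡 m) e.symm x (EuclideanSpace.single j (1 : ℝ)))

/-- The complete contraction of covariant derivatives of the curvature tensor described by `k` and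
`σ`, as a function on `M`. Being invariant under changes of coordinates, it can be computed at `p`
in the preferred chart at `p`. -/
def contraction (g : PseudoRiemannianMetric m M) {r N : ℕ} (k : Fin r → ℕ)
    (σ : Fin N × Fin 2 ≃ (Σ a : Fin r, Fin (4 + k a))) (p : M) : ℝ :=
  completeContraction (g.inChart (chartAt (EuclideanSpace ℝ (Fin m)) p)) k σ
    (chartAt (EuclideanSpace ℝ (Fin m)) p p)

/-- The Weyl scalar invariants of order `ℓ`: the real linear combinations of the complete
contractions of `r ≥ 1` factors `∇^{kₐ}R` in which the metric is differentiated
`∑ₐ (kₐ + 2) = ℓ` times. -/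
def weylInvariants (g : PseudoRiemannianMetric m M) (ℓ : ℕ) : Submodule ℝ (M → ℝ) :=
  Submodule.span ℝ {F | ∃ (r N : ℕ) (k : Fin r → ℕ)
    (σ : Fin N × Fin 2 ≃ (Σ a : Fin r, Fin (4 + k a))),
    0 < r ∧ ∑ a, (k a + 2) = ℓ ∧ F = g.contraction k σ}

/-- All Weyl scalar invariants vanish identically. -/
def IsVSI (g : PseudoRiemannianMetric m M) : Prop :=
  ∀ (ℓ : ℕ), ∀ F ∈ g.weylInvariants ℓ, ∀ p, F p = 0

def IsRiemannian (g : PseudoRiemannianMetric m M) : Prop :=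
  ∀ (p : M) (v : TangentSpace (𝓡 m) p), v ≠ 0 → 0 < g.val p v v

/-- For a Riemannian metric: the infimum of the lengths `∫ √g(γ', γ')` of the `C¹` curves from
`p` to `q`. -/
def edist (g : PseudoRiemannianMetric m M) (p q : M) : ℝ≥0∞ :=
  letI : ∀ x : M, ENorm (TangentSpace (𝓡 m) x) :=
    fun x => ⟨fun v => ENNReal.ofReal (Real.sqrt (g.val x v v))⟩
  riemannianEDist (𝓡 m) p q

/-- The distance between two subsets. -/
def setEDist (g : PseudoRiemannianMetric m M) (A B : Set M) : ℝ≥0∞ :=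
  ⨅ p ∈ A, ⨅ q ∈ B, g.edist p q

/-- Completeness as a metric space: every Cauchy sequence converges. -/
def IsComplete (g : PseudoRiemannianMetric m M) : Prop :=
  ∀ u : ℕ → M, (∀ ε : ℝ≥0∞, 0 < ε → ∃ N, ∀ i ≥ N, ∀ j ≥ N, g.edist (u i) (u j) < ε) →
    ∃ q, Tendsto (fun n => g.edist (u n) q) atTop (𝓝 0)

end PseudoRiemannianMetric

/-- `μ_F(P) = |F(P₀) / F(P)|^{1/ℓ}`. -/
def muFun {M : Type*} (F : M → ℝ) (ℓ : ℕ) (P₀ P : M) : ℝ :=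
  |F P₀ / F P| ^ (1 / (ℓ : ℝ))

/-- The level set `{P | μ_F(P) = c}`. -/
def levelSet {M : Type*} (F : M → ℝ) (ℓ : ℕ) (P₀ : M) (c : ℝ) : Set M :=
  {P | muFun F ℓ P₀ P = c}

end Manifolds

end

/-! ### Calculus on coordinate space -/

section Bilinear

variable {E F ι : Type*} [NormedAddCommGroup E] [NormedSpace ℝ E] [NormedAddCommGroup F]
  [NormedSpace ℝ F]

/-! A homothety with constant `c` preserves the Levi-Civita connection, so each `∇ᵏR`, with all
indices lowered, pulls back to `c²` times itself, while each contraction with the inverse metric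
contributes a further factor `c²`. A complete contraction with `r` factors and `N` pairs therefore
satisfies `c^(2r) F(P) = c^(2N) F(ΦP)`. Counting index slots gives `2N = 2r + ℓ`, hence `F(P) = c^ℓ
F(ΦP)` (`PullsBackTo.weylInvariant`). This is proved in coordinates: the Koszul formula yields the
transformation law of the Christoffel symbols, differentiating that law yields the curvature, and
induction on `k` yields `∇ᵏR`. The case of the identity with two charts gives independence of the
chart, and hence smoothness.

Consequently `μ_F` is a positive smooth function with `μ(ΦP) = λ(Φ) μ(P)`, a "gauge" (`IsGauge`,
`isGauge_muFun`), and the rest uses only this property. By transitivity a gauge is determined by its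
value at `P₀`, so all `μ_F` coincide. A critical point of `μ` would make all points critical and `μ`
constant, against the non-triviality of `λ`; thus levels are hypersurfaces. A homothety joining two
points of one level has `λ = 1`, so levels are orbits of the isometries in `𝓗`.

In the Riemannian case, let `D(c, d)` be the distance between levels. It is additive, because curves
cross intermediate levels and isometries move points freely within a level; and it is homogeneous,
because every positive number is a value of `λ` on `𝓗`. These two properties force `D(c, d) = κ |c -
d|` (`exists_setEDist_eq`). Iterating a homothety with `λ = 1/2` gives a Cauchy sequence along which
`μ → 0`; it cannot converge, since `μ > 0` on `M` (`not_isComplete`). -/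

theorem Module.Basis.bilin_ext (b : Module.Basis ι ℝ E) {B C : E →L[ℝ] E →L[ℝ] F}
    (h : ∀ i j, B (b i) (b j) = C (b i) (b j)) : B = C :=
  ContinuousLinearMap.coe_injective <| b.ext fun i =>
    ContinuousLinearMap.coe_injective <| b.ext fun j => h i j

/-- Both sides are trilinear. The arguments are freed one at a time, with `flip` turning each term
of `D` into a linear map of the argument in question. -/
theorem koszul_of_basis (b : Module.Basis ι ℝ E) {B : E →L[ℝ] E →L[ℝ] ℝ}
    {Γ : E →L[ℝ] E →L[ℝ] E} {D : E →L[ℝ] E →L[ℝ] E →L[ℝ] ℝ}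
    (h : ∀ i j l, 2 * B (Γ (b i) (b j)) (b l)
      = D (b i) (b j) (b l) + D (b j) (b i) (b l) - D (b l) (b i) (b j)) (u v w : E) :
    2 * B (Γ u v) w = D u v w + D v u w - D w u v := by
  have h1 : ∀ i j, ∀ w, 2 * B (Γ (b i) (b j)) w
      = D (b i) (b j) w + D (b j) (b i) w - D w (b i) (b j) := fun i j w => by
    have : (2 : ℝ) • B (Γ (b i) (b j)) = D (b i) (b j) + D (b j) (b i)
        - (D.flip (b i)).flip (b j) :=
      ContinuousLinearMap.coe_injective <| b.ext fun l => by simpa using h i j l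
    simpa using congrArg (fun f => f w) this
  have h2 : ∀ i, ∀ v w, 2 * B (Γ (b i) v) w
      = D (b i) v w + D v (b i) w - D w (b i) v := fun i v w => by
    have : (2 : ℝ) • (B.flip w).comp (Γ (b i)) = (D (b i)).flip w + (D.flip (b i)).flip w
        - (D w) (b i) :=
      ContinuousLinearMap.coe_injective <| b.ext fun l => by simpa using h1 i l w
    simpa using congrArg (fun f => f v) this
  have : (2 : ℝ) • (B.flip w).comp (Γ.flip v) = (D.flip v).flip w + (D v).flip w - (D w).flip v :=
    ContinuousLinearMap.coe_injective <| b.ext fun l => by simpa using h2 l v w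
  simpa using congrArg (fun f => f u) this

theorem HasFDerivAt.bilin_apply_const {B : E → E →L[ℝ] E →L[ℝ] F}
    {B' : E →L[ℝ] E →L[ℝ] E →L[ℝ] F} {x : E} (h : HasFDerivAt B B' x) (v w : E) :
    HasFDerivAt (fun y => B y v w) ((B'.flip v).flip w) x := by
  convert (h.clm_apply (hasFDerivAt_const v x)).clm_apply (hasFDerivAt_const w x) using 1
  ext u
  simp

variable [FiniteDimensional ℝ E] [Fintype ι]

/-- The bilinear map with prescribed values on the pairs of elements of a basis. -/
noncomputable def Module.Basis.bilin (b : Module.Basis ι ℝ E) (c : ι → ι → F) : E →L[ℝ] E →L[ℝ] F :=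
  ∑ i, ∑ j, (b.coord i).toContinuousLinearMap.smulRight
    ((b.coord j).toContinuousLinearMap.smulRight (c i j))

theorem Module.Basis.bilin_apply (b : Module.Basis ι ℝ E) (c : ι → ι → F) (i j : ι) :
    b.bilin c (b i) (b j) = c i j := by
  classical
  simp [Module.Basis.bilin, Finsupp.single_apply]

theorem ContDiffOn.basis_bilin (b : Module.Basis ι ℝ E) {c : E → ι → ι → F} {U : Set E}
    (hc : ∀ i j, ContDiffOn ℝ ∞ (fun x => c x i j) U) :
    ContDiffOn ℝ ∞ (fun x => b.bilin (c x)) U :=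
  ContDiffOn.sum fun i _ => ContDiffOn.sum fun j _ =>
    contDiffOn_const.smulRight (contDiffOn_const.smulRight (hc i j))

end Bilinear

/-! ### Metrics on open sets of coordinate space and their Levi-Civita connection. -/

section LocalGeometry

variable {m : ℕ}

local notation "𝔼" => EuclideanSpace ℝ (Fin m)

/-- The `i`-th coordinate vector field. -/
noncomputable abbrev coordVec (i : Fin m) : EuclideanSpace ℝ (Fin m) := EuclideanSpace.single i 1

/-- The basis of the coordinate vector fields. -/
noncomputable abbrev coordBasis (m : ℕ) : Module.Basis (Fin m) ℝ (EuclideanSpace ℝ (Fin m)) :=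
  (EuclideanSpace.basisFun (Fin m) ℝ).toBasis

theorem coordBasis_apply (i : Fin m) : coordBasis m i = coordVec i := by
  simp [coordBasis]

theorem sum_smul_coordVec (v : 𝔼) : ∑ i, v i • (coordVec i : 𝔼) = v := by
  simpa using (EuclideanSpace.basisFun (Fin m) ℝ).sum_repr v

/-! #### Smoothness -/

theorem ContDiffOn.partialDeriv {f : 𝔼 → ℝ} {U : Set 𝔼} (hU : IsOpen U) (hf : ContDiffOn ℝ ∞ f U)
    (i : Fin m) : ContDiffOn ℝ ∞ (partialDeriv i f) U :=
  (hf.fderiv_of_isOpen hU (by simp)).clm_apply contDiffOn_const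

theorem ContDiffOn.matrix_det {n : ℕ} {A : 𝔼 → Matrix (Fin n) (Fin n) ℝ} {U : Set 𝔼}
    (hA : ∀ i j, ContDiffOn ℝ ∞ (fun x => A x i j) U) :
    ContDiffOn ℝ ∞ (fun x => (A x).det) U := by
  simp only [Matrix.det_apply']
  exact ContDiffOn.sum fun σ _ => contDiffOn_const.mul (contDiffOn_prod fun i _ => hA _ _)

/-- A smooth field of nondegenerate symmetric bilinear forms on an open set, given by its component
matrix. -/
structure IsMetricOn (G : EuclideanSpace ℝ (Fin m) → Matrix (Fin m) (Fin m) ℝ)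
    (U : Set (EuclideanSpace ℝ (Fin m))) : Prop where
  isOpen : IsOpen U
  smooth (i j : Fin m) : ContDiffOn ℝ ∞ (fun x => G x i j) U
  symm : ∀ x ∈ U, ∀ i j, G x i j = G x j i
  isUnit : ∀ x ∈ U, IsUnit (G x).det

namespace IsMetricOn

variable {G : EuclideanSpace ℝ (Fin m) → Matrix (Fin m) (Fin m) ℝ}
  {U : Set (EuclideanSpace ℝ (Fin m))}

/-- Cramer's rule: an entry of the inverse is a determinant with one row made constant, divided by
the nonvanishing `det G`. -/
theorem smooth_inv (hG : IsMetricOn G U) (i j : Fin m) :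
    ContDiffOn ℝ ∞ (fun x => (G x)⁻¹ i j) U := by
  simp only [Matrix.inv_def, Matrix.smul_apply, smul_eq_mul, Ring.inverse_eq_inv',
    Matrix.adjugate_apply]
  refine ((ContDiffOn.matrix_det hG.smooth).inv fun x hx => (hG.isUnit x hx).ne_zero).mul
    (ContDiffOn.matrix_det fun a b => ?_)
  by_cases h : a = j
  · subst h
    simpa [Matrix.updateRow_self] using contDiffOn_const
  · simpa [Matrix.updateRow_ne h] using hG.smooth a b

theorem smooth_christoffel (hG : IsMetricOn G U) (k i j : Fin m) :
    ContDiffOn ℝ ∞ (christoffel G k i j) U :=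
  contDiffOn_const.mul <| ContDiffOn.sum fun l _ => (hG.smooth_inv k l).mul <|
    (((hG.smooth j l).partialDeriv hG.isOpen i).add ((hG.smooth i l).partialDeriv hG.isOpen j)).sub
      ((hG.smooth i j).partialDeriv hG.isOpen l)

theorem smooth_curvatureTensor (hG : IsMetricOn G U) (I : Fin 4 → Fin m) :
    ContDiffOn ℝ ∞ (fun x => curvatureTensor G x I) U :=
  ContDiffOn.sum fun _ _ => (hG.smooth _ _).mul <|
    (((hG.smooth_christoffel _ _ _).partialDeriv hG.isOpen _).sub
      ((hG.smooth_christoffel _ _ _).partialDeriv hG.isOpen _)).add <|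
    ContDiffOn.sum fun _ _ =>
      ((hG.smooth_christoffel _ _ _).mul (hG.smooth_christoffel _ _ _)).sub
      ((hG.smooth_christoffel _ _ _).mul (hG.smooth_christoffel _ _ _))

theorem smooth_covariantDeriv (hG : IsMetricOn G U) {n : ℕ} {T : 𝔼 → (Fin n → Fin m) → ℝ}
    (hT : ∀ I, ContDiffOn ℝ ∞ (fun x => T x I) U) (I : Fin (n + 1) → Fin m) :
    ContDiffOn ℝ ∞ (fun x => covariantDeriv G T x I) U :=
  ((hT _).partialDeriv hG.isOpen _).sub <| ContDiffOn.sum fun _ _ => ContDiffOn.sum fun _ _ =>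
    (hG.smooth_christoffel _ _ _).mul (hT _)

theorem smooth_nablaCurvature (hG : IsMetricOn G U) :
    ∀ (k : ℕ) (I : Fin (4 + k) → Fin m), ContDiffOn ℝ ∞ (fun x => nablaCurvature G k x I) U
  | 0 => hG.smooth_curvatureTensor
  | k + 1 => hG.smooth_covariantDeriv (hG.smooth_nablaCurvature k)

theorem smooth_completeContraction (hG : IsMetricOn G U) {r N : ℕ} (k : Fin r → ℕ)
    (σ : Fin N × Fin 2 ≃ (Σ a : Fin r, Fin (4 + k a))) :
    ContDiffOn ℝ ∞ (completeContraction G k σ) U :=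
  ContDiffOn.sum fun _ _ => (contDiffOn_prod fun _ _ => hG.smooth_inv _ _).mul
    (contDiffOn_prod fun _ _ => hG.smooth_nablaCurvature _ _)

end IsMetricOn

/-! #### The Levi-Civita connection -/

/-- The bilinear form with the given component matrix. -/
noncomputable def bilinForm (A : Matrix (Fin m) (Fin m) ℝ) :
    EuclideanSpace ℝ (Fin m) →L[ℝ] EuclideanSpace ℝ (Fin m) →L[ℝ] ℝ :=
  (coordBasis m).bilin A

theorem bilinForm_coordVec (A : Matrix (Fin m) (Fin m) ℝ) (i j : Fin m) :
    bilinForm A (coordVec i) (coordVec j) = A i j := by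
  simpa only [coordBasis_apply, bilinForm] using (coordBasis m).bilin_apply A i j

/-- The bilinear vector-valued form `Γ` with components the Christoffel symbols. -/
noncomputable def christoffelForm (G : EuclideanSpace ℝ (Fin m) → Matrix (Fin m) (Fin m) ℝ)
    (x : EuclideanSpace ℝ (Fin m)) :
    EuclideanSpace ℝ (Fin m) →L[ℝ] EuclideanSpace ℝ (Fin m) →L[ℝ] EuclideanSpace ℝ (Fin m) :=
  (coordBasis m).bilin fun i j => ∑ k, christoffel G k i j x • coordVec k

theorem christoffelForm_eq_sum (G : 𝔼 → Matrix (Fin m) (Fin m) ℝ) (x : 𝔼) (i j : Fin m) :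
    christoffelForm G x (coordVec i) (coordVec j) = ∑ k, christoffel G k i j x • coordVec k := by
  simpa only [coordBasis_apply, christoffelForm] using (coordBasis m).bilin_apply
    (fun i j => ∑ k, christoffel G k i j x • (coordVec k : 𝔼)) i j

theorem christoffelForm_coordVec (G : 𝔼 → Matrix (Fin m) (Fin m) ℝ) (x : 𝔼) (i j k : Fin m) :
    christoffelForm G x (coordVec i) (coordVec j) k = christoffel G k i j x := by
  simp [christoffelForm_eq_sum, Pi.single_apply]

namespace IsMetricOn

variable {G : EuclideanSpace ℝ (Fin m) → Matrix (Fin m) (Fin m) ℝ}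
  {U : Set (EuclideanSpace ℝ (Fin m))}

theorem smooth_bilinForm (hG : IsMetricOn G U) : ContDiffOn ℝ ∞ (fun x => bilinForm (G x)) U :=
  ContDiffOn.basis_bilin _ hG.smooth

theorem smooth_christoffelForm (hG : IsMetricOn G U) : ContDiffOn ℝ ∞ (christoffelForm G) U :=
  ContDiffOn.basis_bilin _ fun i j => ContDiffOn.sum fun k _ =>
    (hG.smooth_christoffel k i j).smul contDiffOn_const

theorem bilinForm_symm (hG : IsMetricOn G U) {x : 𝔼} (hx : x ∈ U) (u v : 𝔼) :
    bilinForm (G x) u v = bilinForm (G x) v u := by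
  have : bilinForm (G x) = (bilinForm (G x)).flip := (coordBasis m).bilin_ext fun i j => by
    rw [ContinuousLinearMap.flip_apply]
    simp only [coordBasis_apply, bilinForm_coordVec, hG.symm x hx i j]
  exact congrArg (fun f => f u v) this

theorem differentiableAt {F : Type*} [NormedAddCommGroup F] [NormedSpace ℝ F]
    (hG : IsMetricOn G U) {f : 𝔼 → F} (hf : ContDiffOn ℝ ∞ f U) {x : 𝔼} (hx : x ∈ U) :
    DifferentiableAt ℝ f x :=
  (hf.contDiffAt (hG.isOpen.mem_nhds hx)).differentiableAt (by simp)

theorem fderiv_bilinForm_coordVec (hG : IsMetricOn G U) {x : 𝔼} (hx : x ∈ U) (u : 𝔼)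
    (i j : Fin m) :
    fderiv ℝ (fun y => bilinForm (G y)) x u (coordVec i) (coordVec j)
      = fderiv ℝ (fun y => G y i j) x u := by
  have h := ((hG.differentiableAt hG.smooth_bilinForm hx).hasFDerivAt.bilin_apply_const
    (coordVec i) (coordVec j)).fderiv
  simp only [bilinForm_coordVec] at h
  rw [h]
  rfl

/-- The Koszul formula. -/
theorem koszul (hG : IsMetricOn G U) {x : 𝔼} (hx : x ∈ U) (u v w : 𝔼) :
    2 * bilinForm (G x) (christoffelForm G x u v) w
      = fderiv ℝ (fun y => bilinForm (G y)) x u v w + fderiv ℝ (fun y => bilinForm (G y)) x v u w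
        - fderiv ℝ (fun y => bilinForm (G y)) x w u v := by
  refine koszul_of_basis (coordBasis m) (fun i j l => ?_) u v w
  simp only [coordBasis_apply, hG.fderiv_bilinForm_coordVec hx]
  rw [hG.bilinForm_symm hx]
  simp only [christoffelForm_eq_sum, map_sum, map_smul, bilinForm_coordVec, smul_eq_mul,
    christoffel, partialDeriv]
  -- With `D` the bracket in the definition of `christoffel`, the claim is `G (G⁻¹ D) = D`.
  set D : Fin m → ℝ := fun a => fderiv ℝ (fun y => G y j a) x (coordVec i)
    + fderiv ℝ (fun y => G y i a) x (coordVec j) - fderiv ℝ (fun y => G y i j) x (coordVec a)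
  change 2 * ∑ k, 1 / 2 * (∑ a, (G x)⁻¹ k a * D a) * G x l k = D l
  have h : ∑ k, G x l k * ∑ a, (G x)⁻¹ k a * D a = D l := by
    have h1 : (G x).mulVec ((G x)⁻¹.mulVec D) = D := by
      rw [Matrix.mulVec_mulVec, Matrix.mul_nonsing_inv _ (hG.isUnit x hx), Matrix.one_mulVec]
    exact congrFun h1 l
  rw [← h, Finset.mul_sum]
  exact Finset.sum_congr rfl fun k _ => by ring

theorem bilinForm_nondegenerate (hG : IsMetricOn G U) {x : 𝔼} (hx : x ∈ U) {u : 𝔼}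
    (h : ∀ v, bilinForm (G x) u v = 0) : u = 0 := by
  have h1 : Matrix.vecMul (fun i => u i) (G x) = 0 := by
    ext j
    have := h (coordVec j)
    rw [hG.bilinForm_symm hx, ← sum_smul_coordVec u] at this
    change ∑ i, u i * G x i j = 0
    simpa only [map_sum, map_smul, bilinForm_coordVec, smul_eq_mul, hG.symm x hx j] using this
  have h2 : (fun i => u i) = 0 := by
    rw [← Matrix.vecMul_one (fun i => u i), ← Matrix.mul_nonsing_inv _ (hG.isUnit x hx),
      ← Matrix.vecMul_vecMul, h1, Matrix.zero_vecMul]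
  ext i
  exact congrFun h2 i

end IsMetricOn

end LocalGeometry

/-! ### The transformation law of the connection and of the curvature -/

section ConnectionPullback

variable {E : Type*} [NormedAddCommGroup E] [NormedSpace ℝ E]

/-- Leibniz rule with three moving parts. The derivative is left existential because only its values
are ever used. -/
theorem exists_hasFDerivAt_bilin_apply {X F H : Type*} [NormedAddCommGroup X] [NormedSpace ℝ X]
    [NormedAddCommGroup F] [NormedSpace ℝ F] [NormedAddCommGroup H] [NormedSpace ℝ H]
    {B : X → F →L[ℝ] F →L[ℝ] H} {B' : X →L[ℝ] F →L[ℝ] F →L[ℝ] H} {f g : X → F}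
    {f' g' : X →L[ℝ] F} {x : X} (hB : HasFDerivAt B B' x) (hf : HasFDerivAt f f' x)
    (hg : HasFDerivAt g g' x) : ∃ L : X →L[ℝ] H, HasFDerivAt (fun y => B y (f y) (g y)) L x ∧
      ∀ w, L w = B' w (f x) (g x) + B x (f' w) (g x) + B x (f x) (g' w) :=
  ⟨_, (hB.clm_apply hf).clm_apply hg, fun w => by simp; abel⟩

/-- The vector `R(u, v) w` for the connection with Christoffel form `Γ`. -/
noncomputable def curvatureVec (Γ : E → E →L[ℝ] E →L[ℝ] E) (x u v w : E) : E :=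
  fderiv ℝ Γ x u v w - fderiv ℝ Γ x v u w + Γ x u (Γ x v w) - Γ x v (Γ x u w)

/-- The curvature tensor as a multilinear form. -/
noncomputable def curvatureForm (B : E →L[ℝ] E →L[ℝ] ℝ) (Γ : E → E →L[ℝ] E →L[ℝ] E) (x : E) :
    MultilinearMap ℝ (fun _ : Fin 4 => E) ℝ :=
  MultilinearMap.mk' (fun v => B (curvatureVec Γ x (v 0) (v 1) (v 2)) (v 3))
    (by
      intro v i u w
      simp only [curvatureVec]
      generalize fderiv ℝ Γ x = D
      generalize Γ x = C
      fin_cases i <;>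
      simp only [Function.update, Fin.isValue, Fin.zero_eta, Fin.mk_one, Fin.reduceFinMk,
        Fin.reduceEq, dite_true, dite_false, one_ne_zero, zero_ne_one, ContinuousLinearMap.map_add, ContinuousLinearMap.map_sub,
        _root_.add_apply, _root_.sub_apply] <;> ring)
    (by
      intro v i c w
      simp only [curvatureVec]
      generalize fderiv ℝ Γ x = D
      generalize Γ x = C
      fin_cases i <;>
      simp only [Function.update, Fin.isValue, Fin.zero_eta, Fin.mk_one, Fin.reduceFinMk,
        Fin.reduceEq, dite_true, dite_false, one_ne_zero, zero_ne_one, ContinuousLinearMap.map_smul, ContinuousLinearMap.map_add,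
        ContinuousLinearMap.map_sub, _root_.add_apply, _root_.sub_apply,
        _root_.smul_apply, smul_eq_mul] <;> ring)

theorem ContDiffAt.hasFDerivAt_fderiv_apply {φ : E → E} {x : E} (h : ContDiffAt ℝ ∞ φ x) (u : E) :
    HasFDerivAt (fun y => fderiv ℝ φ y u) ((fderiv ℝ (fderiv ℝ φ) x).flip u) x := by
  have h1 : DifferentiableAt ℝ (fderiv ℝ φ) x :=
    (h.fderiv_right (m := ∞) (by simp)).differentiableAt (by simp)
  convert h1.hasFDerivAt.clm_apply (hasFDerivAt_const u x) using 1
  ext w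
  simp

theorem ContDiffAt.fderiv_fderiv_comm {F : Type*} [NormedAddCommGroup F] [NormedSpace ℝ F]
    {φ : E → F} {x : E} (h : ContDiffAt ℝ ∞ φ x) (u v : E) :
    fderiv ℝ (fderiv ℝ φ) x u v = fderiv ℝ (fderiv ℝ φ) x v u :=
  h.isSymmSndFDerivAt (by simpa using WithTop.coe_le_coe.2 (le_top : (2 : ℕ∞) ≤ ⊤)) u v

theorem ContDiffAt.differentiableAt_infty {F : Type*} [NormedAddCommGroup F] [NormedSpace ℝ F]
    {f : E → F} {x : E} (h : ContDiffAt ℝ ∞ f x) : DifferentiableAt ℝ f x :=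
  h.differentiableAt (by simp)

/-- The transformation law of the Christoffel symbols under a homothety `φ`. -/
theorem fderiv_fderiv_add_christoffel {φ : E → E} {B B' : E → E →L[ℝ] E →L[ℝ] ℝ}
    {Γ Γ' : E →L[ℝ] E →L[ℝ] E} {x : E} {a : ℝ} (hφ : ContDiffAt ℝ ∞ φ x)
    (hB : DifferentiableAt ℝ B x) (hB' : DifferentiableAt ℝ B' (φ x))
    (hpull : ∀ᶠ y in 𝓝 x, ∀ u v, B' (φ y) (fderiv ℝ φ y u) (fderiv ℝ φ y v) = a * B y u v)
    (hsymm : ∀ u v, B' (φ x) u v = B' (φ x) v u)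
    (hnondeg : ∀ z, (∀ w, B' (φ x) z (fderiv ℝ φ x w) = 0) → z = 0)
    (hK : ∀ u v w, 2 * B x (Γ u v) w = fderiv ℝ B x u v w + fderiv ℝ B x v u w
      - fderiv ℝ B x w u v)
    (hK' : ∀ u v w, 2 * B' (φ x) (Γ' u v) w = fderiv ℝ B' (φ x) u v w + fderiv ℝ B' (φ x) v u w
      - fderiv ℝ B' (φ x) w u v) (u v : E) :
    fderiv ℝ (fderiv ℝ φ) x u v + Γ' (fderiv ℝ φ x u) (fderiv ℝ φ x v)
      = fderiv ℝ φ x (Γ u v) := by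
  -- The pullback identity differentiated in direction `w`.
  have hD : ∀ w u v, fderiv ℝ B' (φ x) (fderiv ℝ φ x w) (fderiv ℝ φ x u) (fderiv ℝ φ x v)
      + B' (φ x) (fderiv ℝ (fderiv ℝ φ) x w u) (fderiv ℝ φ x v)
      + B' (φ x) (fderiv ℝ φ x u) (fderiv ℝ (fderiv ℝ φ) x w v) = a * fderiv ℝ B x w u v := by
    intro w u v
    obtain ⟨L, h1, hL⟩ := exists_hasFDerivAt_bilin_apply
      (HasFDerivAt.comp (g := B') x hB'.hasFDerivAt hφ.differentiableAt_infty.hasFDerivAt)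
      (hφ.hasFDerivAt_fderiv_apply u) (hφ.hasFDerivAt_fderiv_apply v)
    have h2 := (hB.hasFDerivAt.bilin_apply_const u v).const_mul a
    have h3 := (h1.congr_of_eventuallyEq (f₁ := fun y => a * B y u v)
      (hpull.mono fun y hy => (hy u v).symm)).unique h2
    have h4 := hL w
    rw [h3] at h4
    exact h4.symm
  rw [← sub_eq_zero]
  refine hnondeg _ fun w => ?_
  have e1 := hD u v w
  have e2 := hD v u w
  have e3 := hD w u v
  have e4 := hK u v w
  have e5 := hK' (fderiv ℝ φ x u) (fderiv ℝ φ x v) (fderiv ℝ φ x w)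
  have e6 := hpull.self_of_nhds (Γ u v) w
  rw [hφ.fderiv_fderiv_comm v u] at e2
  rw [hφ.fderiv_fderiv_comm w u, hφ.fderiv_fderiv_comm w v] at e3
  have e7 := hsymm (fderiv ℝ φ x v) (fderiv ℝ (fderiv ℝ φ) x u w)
  simp only [map_sub, map_add, _root_.sub_apply, _root_.add_apply]
  -- The combination `e1 + e2 - e3` is that of the Koszul formula: by symmetry of second
  -- derivatives, of the six terms containing `D²φ` only the two with `D²φ(u, v)` survive.
  linear_combination (1 / 2) * e1 + (1 / 2) * e2 - (1 / 2) * e3 + (1 / 2) * e5 - e6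
    - (a / 2) * e4 - (1 / 2) * e7

/-- The curvature is natural under maps that respect the connections. -/
theorem fderiv_curvatureVec {φ : E → E} {Γ Γ' : E → E →L[ℝ] E →L[ℝ] E} {x : E}
    (hφ : ContDiffAt ℝ ∞ φ x) (hΓ : DifferentiableAt ℝ Γ x) (hΓ' : DifferentiableAt ℝ Γ' (φ x))
    (h : ∀ᶠ y in 𝓝 x, ∀ u v, fderiv ℝ (fderiv ℝ φ) y u v
      + Γ' (φ y) (fderiv ℝ φ y u) (fderiv ℝ φ y v) = fderiv ℝ φ y (Γ y u v)) (u v w : E) :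
    fderiv ℝ φ x (curvatureVec Γ x u v w)
      = curvatureVec Γ' (φ x) (fderiv ℝ φ x u) (fderiv ℝ φ x v) (fderiv ℝ φ x w) := by
  have hφ1 : ContDiffAt ℝ ∞ (fderiv ℝ φ) x := hφ.fderiv_right (by simp)
  have hφ2 : ContDiffAt ℝ ∞ (fderiv ℝ (fderiv ℝ φ)) x := hφ1.fderiv_right (by simp)
  have h0 := h.self_of_nhds
  -- The transformation law of `Γ`, applied to `v, w`, differentiated in direction `u`.
  have hD : ∀ u v w, fderiv ℝ (fderiv ℝ (fderiv ℝ φ)) x u v w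
      + (fderiv ℝ Γ' (φ x) (fderiv ℝ φ x u) (fderiv ℝ φ x v) (fderiv ℝ φ x w)
      + Γ' (φ x) (fderiv ℝ (fderiv ℝ φ) x u v) (fderiv ℝ φ x w)
      + Γ' (φ x) (fderiv ℝ φ x v) (fderiv ℝ (fderiv ℝ φ) x u w))
      = fderiv ℝ (fderiv ℝ φ) x u (Γ x v w) + fderiv ℝ φ x (fderiv ℝ Γ x u v w) := by
    intro u v w
    obtain ⟨L, h1, hL⟩ := exists_hasFDerivAt_bilin_apply
      (HasFDerivAt.comp (g := Γ') x hΓ'.hasFDerivAt hφ.differentiableAt_infty.hasFDerivAt)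
      (hφ.hasFDerivAt_fderiv_apply v) (hφ.hasFDerivAt_fderiv_apply w)
    have h2 := (hφ2.differentiableAt_infty.hasFDerivAt.bilin_apply_const v w).add h1
    have h3 := hφ1.differentiableAt_infty.hasFDerivAt.clm_apply
      (hΓ.hasFDerivAt.bilin_apply_const v w)
    have h4 := (h2.congr_of_eventuallyEq (f₁ := fun y => fderiv ℝ φ y (Γ y v w))
      (h.mono fun y hy => (hy v w).symm)).unique h3
    have h5 := congrArg (fun f => f u) h4
    simp only [_root_.add_apply, hL] at h5
    refine h5.trans (add_comm _ _)
  have hD' : fderiv ℝ (fderiv ℝ (fderiv ℝ φ)) x u v = fderiv ℝ (fderiv ℝ (fderiv ℝ φ)) x v u :=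
    hφ1.fderiv_fderiv_comm u v
  -- `hD` solved for the derivative of `Γ`, with the transformation law eliminating every second
  -- derivative of `φ` except `D²φ(u, v)`.
  have key : ∀ u v, fderiv ℝ φ x (fderiv ℝ Γ x u v w)
      = fderiv ℝ (fderiv ℝ (fderiv ℝ φ)) x u v w
      + fderiv ℝ Γ' (φ x) (fderiv ℝ φ x u) (fderiv ℝ φ x v) (fderiv ℝ φ x w)
      + Γ' (φ x) (fderiv ℝ (fderiv ℝ φ) x u v) (fderiv ℝ φ x w)
      + Γ' (φ x) (fderiv ℝ φ x v) (fderiv ℝ φ x (Γ x u w))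
      - Γ' (φ x) (fderiv ℝ φ x v) (Γ' (φ x) (fderiv ℝ φ x u) (fderiv ℝ φ x w))
      - (fderiv ℝ φ x (Γ x u (Γ x v w)) - Γ' (φ x) (fderiv ℝ φ x u) (fderiv ℝ φ x (Γ x v w))) := by
    intro u v
    have e1 := hD u v w
    rw [eq_sub_of_add_eq (h0 u w), eq_sub_of_add_eq (h0 u (Γ x v w)), map_sub] at e1
    refine (sub_eq_iff_eq_add'.2 e1).symm.trans ?_
    abel
  -- Antisymmetrising in `u, v` kills `D³φ` and the term with `D²φ(u, v)`; what remains is the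
  -- curvature of `Γ'`.
  simp only [curvatureVec, map_sub, map_add]
  rw [key u v, key v u, hD', hφ.fderiv_fderiv_comm v u]
  abel

end ConnectionPullback

/-! ### The transformation law of tensors and of their contractions -/

section Tensors

variable {m : ℕ} {ι : Type*} [Fintype ι] [DecidableEq ι]

local notation "𝔼" => EuclideanSpace ℝ (Fin m)

/-- The multilinear form with components `T`. -/
noncomputable def evalTensor (T : (ι → Fin m) → ℝ) :
    MultilinearMap ℝ (fun _ : ι => EuclideanSpace ℝ (Fin m)) ℝ :=
  ∑ K, T K • (MultilinearMap.mkPiAlgebra ℝ ι ℝ).compLinearMap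
    fun s => ((EuclideanSpace.proj (K s) : 𝔼 →L[ℝ] ℝ) : 𝔼 →ₗ[ℝ] ℝ)

theorem evalTensor_apply (T : (ι → Fin m) → ℝ) (v : ι → 𝔼) :
    evalTensor T v = ∑ K, (∏ s, v s (K s)) * T K := by
  simp [evalTensor, mul_comm]

theorem evalTensor_coordVec (T : (ι → Fin m) → ℝ) (I : ι → Fin m) :
    evalTensor T (fun s => coordVec (I s)) = T I := by
  rw [evalTensor_apply, Finset.sum_eq_single I]
  · simp
  · intro K _ hK
    obtain ⟨s, hs⟩ := Function.ne_iff.1 hK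
    rw [Finset.prod_eq_zero (Finset.mem_univ s) (by simp [hs]), zero_mul]
  · simp

theorem MultilinearMap.eq_evalTensor (F : MultilinearMap ℝ (fun _ : ι => 𝔼) ℝ) :
    F = evalTensor fun I => F fun s => coordVec (I s) := by
  ext v
  conv_lhs => rw [show v = fun s => ∑ i, v s i • (coordVec i : 𝔼) from
    funext fun s => (sum_smul_coordVec (v s)).symm]
  rw [F.map_sum, evalTensor_apply]
  exact Finset.sum_congr rfl fun K _ => F.map_smul_univ _ _

/-- Turns a linear map acting in one slot into a sum over one index, the shape of the correction
terms in `covariantDeriv`. -/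
theorem evalTensor_update_linearMap (T : (ι → Fin m) → ℝ) (L : 𝔼 →ₗ[ℝ] 𝔼) (v : ι → 𝔼) (s : ι) :
    evalTensor T (Function.update v s (L (v s)))
      = evalTensor (fun K => ∑ b, L (coordVec (K s)) b * T (Function.update K s b)) v := by
  have h := ((evalTensor T).compLinearMap fun t => if t = s then L else LinearMap.id).eq_evalTensor
  have e : ∀ v : ι → 𝔼, (fun t => (if t = s then L else LinearMap.id : 𝔼 →ₗ[ℝ] 𝔼) (v t))
      = Function.update v s (L (v s)) := by
    intro v
    ext1 t
    by_cases ht : t = s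
    · subst ht; simp
    · simp [ht]
  have h1 := congrArg (fun F => F v) h
  simp only [MultilinearMap.compLinearMap_apply, e] at h1
  rw [h1]
  congr 2
  ext K
  conv_lhs => rw [← sum_smul_coordVec (L (coordVec (K s)))]
  rw [MultilinearMap.map_update_sum]
  refine Finset.sum_congr rfl fun b _ => ?_
  rw [MultilinearMap.map_update_smul, smul_eq_mul, ← evalTensor_coordVec T]
  congr 2
  ext1 t
  by_cases ht : t = s
  · subst ht; simp
  · simp [ht]

/-- Leibniz rule for a tensor evaluated on moving vectors; it is applied to the components composed
with `φ` and the vectors `dφ(∂ᵢ)`. -/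
theorem exists_hasFDerivAt_evalTensor {T : 𝔼 → (ι → Fin m) → ℝ} {v : 𝔼 → ι → 𝔼}
    {T' : (ι → Fin m) → 𝔼 →L[ℝ] ℝ} {v' : ι → 𝔼 →L[ℝ] 𝔼} {x : 𝔼}
    (hT : ∀ K, HasFDerivAt (fun y => T y K) (T' K) x)
    (hv : ∀ s, HasFDerivAt (fun y => v y s) (v' s) x) :
    ∃ L : 𝔼 →L[ℝ] ℝ, HasFDerivAt (fun y => evalTensor (T y) (v y)) L x ∧
      ∀ w, L w = evalTensor (fun K => T' K w) (v x)
        + ∑ s, evalTensor (T x) (Function.update (v x) s (v' s w)) := by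
  have h : ∀ K : ι → Fin m, HasFDerivAt (fun y => ∏ s, v y s (K s))
      (∑ s, (∏ t ∈ Finset.univ.erase s, v x t (K t)) • (EuclideanSpace.proj (K s)).comp (v' s)) x :=
    fun K => HasFDerivAt.finsetProd fun s _ =>
      (EuclideanSpace.proj (K s) : 𝔼 →L[ℝ] ℝ).hasFDerivAt.comp x (hv s)
  simp only [evalTensor_apply]
  refine ⟨_, HasFDerivAt.fun_sum fun K _ => (h K).mul (hT K), fun w => ?_⟩
  rw [Finset.sum_comm, ← Finset.sum_add_distrib, _root_.sum_apply]
  refine Finset.sum_congr rfl fun K _ => ?_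
  simp only [_root_.add_apply, _root_.smul_apply, _root_.sum_apply, smul_eq_mul,
    ContinuousLinearMap.comp_apply, PiLp.proj_apply, ← Finset.sum_mul]
  rw [mul_comm (T x K)]
  congr 2
  refine Finset.sum_congr rfl fun s _ => ?_
  rw [← Finset.mul_prod_erase _ _ (Finset.mem_univ s), Function.update_self, mul_comm]
  congr 1
  refine Finset.prod_congr rfl fun t ht => ?_
  rw [Function.update_of_ne (Finset.ne_of_mem_erase ht)]

end Tensors

/-! ### Naturality of the curvature and its covariant derivatives under local homotheties. -/

section Naturality

variable {m : ℕ}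

local notation "𝔼" => EuclideanSpace ℝ (Fin m)

/-- The formula for `∇_w T` on arbitrary vectors. It is needed because `φ` carries coordinate
vectors to vectors that are not coordinate vectors. -/
theorem evalTensor_covariantDeriv {n : ℕ} (G : 𝔼 → Matrix (Fin m) (Fin m) ℝ)
    (T : 𝔼 → (Fin n → Fin m) → ℝ) (x : 𝔼) (v : Fin n → 𝔼) (w : 𝔼) :
    evalTensor (covariantDeriv G T x) (Fin.snoc v w : Fin (n + 1) → 𝔼)
      = evalTensor (fun K => fderiv ℝ (fun y => T y K) x w) v
        - ∑ s, evalTensor (T x) (Function.update v s (christoffelForm G x w (v s))) := by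
  have h : ∀ s, evalTensor (T x) (Function.update v s (christoffelForm G x w (v s)))
      = evalTensor (fun K => ∑ b, christoffelForm G x w (coordVec (K s)) b
          * T x (Function.update K s b)) v := fun s =>
    evalTensor_update_linearMap (T x) (christoffelForm G x w : 𝔼 →ₗ[ℝ] 𝔼) v s
  have hw : ∀ f : 𝔼 →L[ℝ] ℝ, f w = ∑ j, w j * f (coordVec j) := fun f => by
    conv_lhs => rw [← sum_smul_coordVec w]
    simp
  have hΓ : ∀ i b, christoffelForm G x w (coordVec i) b = ∑ j, w j * christoffel G b j i x :=
    fun i b => by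
      conv_lhs => rw [← sum_smul_coordVec w]
      simp [christoffelForm_coordVec]
  simp only [h, evalTensor_apply]
  rw [Finset.sum_comm, ← Finset.sum_sub_distrib]
  -- A multi-index of rank `n + 1` is split into its first `n` entries and the last one, the
  -- direction of differentiation.
  rw [← (Fin.snocEquiv fun _ => Fin m).sum_comp, Fintype.sum_prod_type_right]
  refine Finset.sum_congr rfl fun K _ => ?_
  have hinit : ∀ j, Fin.init (Fin.snocEquiv (fun _ => Fin m) (j, K)) = K := fun j =>
    Fin.init_snoc (α := fun _ => Fin m) j K
  have hlast : ∀ j, Fin.snocEquiv (fun _ => Fin m) (j, K) (Fin.last n) = j := fun j =>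
    Fin.snoc_last (α := fun _ => Fin m) j K
  have hcast : ∀ j (s : Fin n), Fin.snocEquiv (fun _ => Fin m) (j, K) s.castSucc = K s :=
    fun j s => Fin.snoc_castSucc (α := fun _ => Fin m) j K s
  simp only [hw, hΓ, covariantDeriv, Fin.prod_univ_castSucc, Fin.snoc_castSucc,
    Fin.snoc_last, partialDeriv, hinit, hlast, hcast]
  rw [← Finset.mul_sum, ← mul_sub]
  simp only [mul_assoc]
  rw [← Finset.mul_sum]
  simp only [mul_sub, Finset.sum_sub_distrib, Finset.sum_mul, Finset.mul_sum]
  refine congrArg (fun t : ℝ => _ - t) ?_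
  rw [Finset.sum_comm]
  refine Finset.sum_congr rfl fun s _ => ?_
  rw [Finset.sum_comm]
  simp only [mul_assoc]

theorem fderiv_christoffelForm_coordVec {G : 𝔼 → Matrix (Fin m) (Fin m) ℝ} {x : 𝔼}
    (h : DifferentiableAt ℝ (christoffelForm G) x) (w : 𝔼) (i j k : Fin m) :
    fderiv ℝ (christoffelForm G) x w (coordVec i) (coordVec j) k
      = fderiv ℝ (christoffel G k i j) x w := by
  have h1 := ((EuclideanSpace.proj k : 𝔼 →L[ℝ] ℝ).hasFDerivAt.comp x
    (h.hasFDerivAt.bilin_apply_const (coordVec i) (coordVec j))).fderiv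
  have h2 : (EuclideanSpace.proj k : 𝔼 →L[ℝ] ℝ) ∘
      (fun y => christoffelForm G y (coordVec i) (coordVec j)) = christoffel G k i j := by
    ext y
    exact christoffelForm_coordVec G y i j k
  rw [h2] at h1
  rw [h1]
  rfl

theorem curvatureForm_coordVec {G : 𝔼 → Matrix (Fin m) (Fin m) ℝ} {U : Set 𝔼}
    (hG : IsMetricOn G U) {x : 𝔼} (hx : x ∈ U) (I : Fin 4 → Fin m) :
    curvatureForm (bilinForm (G x)) (christoffelForm G) x (fun s => coordVec (I s))
      = curvatureTensor G x I := by
  have hd := hG.differentiableAt hG.smooth_christoffelForm hx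
  have hΓΓ : ∀ i j k a, christoffelForm G x (coordVec i)
      (christoffelForm G x (coordVec j) (coordVec k)) a
      = ∑ b, christoffel G a i b x * christoffel G b j k x := by
    intro i j k a
    rw [christoffelForm_eq_sum G x j k]
    simp [christoffelForm_coordVec, mul_comm]
  change bilinForm (G x) (curvatureVec (christoffelForm G) x _ _ _) _ = _
  conv_lhs => rw [← sum_smul_coordVec (curvatureVec (christoffelForm G) x _ _ _)]
  simp only [map_sum, map_smul, _root_.sum_apply, _root_.smul_apply, bilinForm_coordVec,
    smul_eq_mul, curvatureTensor]
  refine Finset.sum_congr rfl fun a _ => ?_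
  rw [mul_comm]
  congr 1
  simp only [curvatureVec, PiLp.sub_apply, PiLp.add_apply, fderiv_christoffelForm_coordVec hd, hΓΓ,
    Finset.sum_sub_distrib, partialDeriv]
  ring

/-- A smooth map `φ` between open sets with `φ^* G' = c² G`. -/
structure IsLocalHomothety (c : ℝ) (φ : EuclideanSpace ℝ (Fin m) → EuclideanSpace ℝ (Fin m))
    (G G' : EuclideanSpace ℝ (Fin m) → Matrix (Fin m) (Fin m) ℝ)
    (U V : Set (EuclideanSpace ℝ (Fin m))) : Prop where
  metric : IsMetricOn G U
  metric' : IsMetricOn G' V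
  smooth : ContDiffOn ℝ ∞ φ U
  mapsTo : MapsTo φ U V
  ne_zero : c ≠ 0
  pull : ∀ x ∈ U, ∀ u v, bilinForm (G' (φ x)) (fderiv ℝ φ x u) (fderiv ℝ φ x v)
    = c ^ 2 * bilinForm (G x) u v

namespace IsLocalHomothety

variable {c : ℝ} {φ : EuclideanSpace ℝ (Fin m) → EuclideanSpace ℝ (Fin m)}
  {G G' : EuclideanSpace ℝ (Fin m) → Matrix (Fin m) (Fin m) ℝ}
  {U V : Set (EuclideanSpace ℝ (Fin m))}

theorem contDiffAt (h : IsLocalHomothety c φ G G' U V) {x : 𝔼} (hx : x ∈ U) :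
    ContDiffAt ℝ ∞ φ x :=
  h.smooth.contDiffAt (h.metric.isOpen.mem_nhds hx)

/-- The pulled-back form is nondegenerate, so `dφ` is injective, and source and target have equal
dimension. -/
theorem surjective (h : IsLocalHomothety c φ G G' U V) {x : 𝔼} (hx : x ∈ U) :
    Function.Surjective (fderiv ℝ φ x) := by
  refine (LinearMap.injective_iff_surjective (f := (fderiv ℝ φ x : 𝔼 →ₗ[ℝ] 𝔼))).1 ?_
  refine (injective_iff_map_eq_zero _).2 fun u hu => h.metric.bilinForm_nondegenerate hx fun v => ?_
  have h1 := h.pull x hx u v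
  have hu' : fderiv ℝ φ x u = 0 := hu
  rw [hu'] at h1
  simpa [h.ne_zero] using h1.symm

theorem fderiv_fderiv (h : IsLocalHomothety c φ G G' U V) {x : 𝔼} (hx : x ∈ U) (u v : 𝔼) :
    fderiv ℝ (fderiv ℝ φ) x u v
      + christoffelForm G' (φ x) (fderiv ℝ φ x u) (fderiv ℝ φ x v)
      = fderiv ℝ φ x (christoffelForm G x u v) := by
  refine fderiv_fderiv_add_christoffel (B := fun y => bilinForm (G y))
    (B' := fun y => bilinForm (G' y)) (a := c ^ 2) (h.contDiffAt hx)
    (h.metric.differentiableAt h.metric.smooth_bilinForm hx)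
    (h.metric'.differentiableAt h.metric'.smooth_bilinForm (h.mapsTo hx))
    (eventually_of_mem (h.metric.isOpen.mem_nhds hx) h.pull)
    (h.metric'.bilinForm_symm (h.mapsTo hx)) (fun z hz => ?_)
    (h.metric.koszul hx) (h.metric'.koszul (h.mapsTo hx)) u v
  refine h.metric'.bilinForm_nondegenerate (h.mapsTo hx) fun v => ?_
  obtain ⟨w, rfl⟩ := h.surjective hx v
  exact hz w

theorem curvatureVec (h : IsLocalHomothety c φ G G' U V) {x : 𝔼} (hx : x ∈ U) (u v w : 𝔼) :
    fderiv ℝ φ x (curvatureVec (christoffelForm G) x u v w)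
      = _root_.curvatureVec (christoffelForm G') (φ x) (fderiv ℝ φ x u) (fderiv ℝ φ x v)
        (fderiv ℝ φ x w) :=
  fderiv_curvatureVec (h.contDiffAt hx)
    (h.metric.differentiableAt h.metric.smooth_christoffelForm hx)
    (h.metric'.differentiableAt h.metric'.smooth_christoffelForm (h.mapsTo hx))
    (eventually_of_mem (h.metric.isOpen.mem_nhds hx) fun _ hy => h.fderiv_fderiv hy) u v w

theorem curvatureTensor (h : IsLocalHomothety c φ G G' U V) {x : 𝔼} (hx : x ∈ U)
    (I : Fin 4 → Fin m) :
    c ^ 2 * curvatureTensor G x I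
      = evalTensor (curvatureTensor G' (φ x)) (fun s => fderiv ℝ φ x (coordVec (I s))) := by
  have h1 := (curvatureForm (bilinForm (G' (φ x))) (christoffelForm G') (φ x)).eq_evalTensor
  simp only [curvatureForm_coordVec h.metric' (h.mapsTo hx)] at h1
  rw [← curvatureForm_coordVec h.metric hx, ← h1]
  refine (h.pull x hx _ _).symm.trans ?_
  rw [h.curvatureVec hx]
  rfl

/-- Differentiating the transformation law of `T` produces terms in `D²φ`; the law of the
Christoffel symbols converts exactly these into the two connection corrections. The factor `a` is
unaffected. -/
theorem covariantDeriv (h : IsLocalHomothety c φ G G' U V) {n : ℕ} {a : ℝ}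
    {T T' : 𝔼 → (Fin n → Fin m) → ℝ} (hT : ∀ I, ContDiffOn ℝ ∞ (fun x => T x I) U)
    (hT' : ∀ I, ContDiffOn ℝ ∞ (fun x => T' x I) V)
    (hTT' : ∀ x ∈ U, ∀ I, a * T x I
      = evalTensor (T' (φ x)) (fun s => fderiv ℝ φ x (coordVec (I s))))
    {x : 𝔼} (hx : x ∈ U) (I : Fin (n + 1) → Fin m) :
    a * covariantDeriv G T x I
      = evalTensor (covariantDeriv G' T' (φ x)) (fun s => fderiv ℝ φ x (coordVec (I s))) := by
  have hsnoc : (fun s => fderiv ℝ φ x (coordVec (I s)))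
      = (Fin.snoc (fun s => fderiv ℝ φ x (coordVec (Fin.init I s)))
          (fderiv ℝ φ x (coordVec (I (Fin.last n)))) : Fin (n + 1) → 𝔼) := by
    refine (Fin.snoc_init_self (α := fun _ => 𝔼) _).symm
  rw [hsnoc, evalTensor_covariantDeriv]
  set j := I (Fin.last n) with hj
  set J : Fin n → Fin m := Fin.init I with hJ
  set A : Fin n → 𝔼 := fun s => fderiv ℝ φ x (coordVec (J s)) with hA
  have hφ := h.contDiffAt hx
  have hd : a * partialDeriv j (fun y => T y J) x
      = evalTensor (fun K => fderiv ℝ (fun y => T' y K) (φ x) (fderiv ℝ φ x (coordVec j))) A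
        + ∑ s, evalTensor (T' (φ x))
            (Function.update A s (fderiv ℝ (fderiv ℝ φ) x (coordVec j) (coordVec (J s)))) := by
    obtain ⟨L, h1, hL⟩ := exists_hasFDerivAt_evalTensor (T := fun y => T' (φ y))
      (v := fun y s => fderiv ℝ φ y (coordVec (J s)))
      (fun K => HasFDerivAt.comp (g := fun y => T' y K) x
        (h.metric'.differentiableAt (hT' K) (h.mapsTo hx)).hasFDerivAt
        hφ.differentiableAt_infty.hasFDerivAt)
      (fun s => hφ.hasFDerivAt_fderiv_apply (coordVec (J s)))
    have h2 := (h.metric.differentiableAt (hT J) hx).hasFDerivAt.const_mul a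
    have h3 := (h1.congr_of_eventuallyEq (f₁ := fun y => a * T y J)
      (eventually_of_mem (h.metric.isOpen.mem_nhds hx) fun y hy => hTT' y hy J)).unique h2
    have h4 := hL (coordVec j)
    rw [h3] at h4
    exact h4
  -- `D²φ = dφ(Γ) - Γ'(dφ, dφ)`: the first part gives the correction of `T`, the second that of
  -- `T'`.
  have hs : ∀ s, evalTensor (T' (φ x))
      (Function.update A s (fderiv ℝ (fderiv ℝ φ) x (coordVec j) (coordVec (J s))))
      = a * ∑ b, christoffel G b j (J s) x * T x (Function.update J s b)
        - evalTensor (T' (φ x)) (Function.update A s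
            (christoffelForm G' (φ x) (fderiv ℝ φ x (coordVec j)) (A s))) := by
    intro s
    rw [eq_sub_of_add_eq (h.fderiv_fderiv hx (coordVec j) (coordVec (J s))),
      MultilinearMap.map_update_sub, christoffelForm_eq_sum, map_sum, MultilinearMap.map_update_sum,
      Finset.mul_sum]
    congr 1
    refine Finset.sum_congr rfl fun b _ => ?_
    rw [map_smul, MultilinearMap.map_update_smul, smul_eq_mul, mul_left_comm, hTT' x hx]
    congr 2
    ext1 t
    by_cases ht : t = s
    · subst ht; simp
    · simp [ht, hA]
  simp only [_root_.covariantDeriv]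
  rw [mul_sub, hd]
  simp only [hs, Finset.sum_sub_distrib, Finset.mul_sum]
  ring

theorem nablaCurvature (h : IsLocalHomothety c φ G G' U V) :
    ∀ (k : ℕ) {x : 𝔼} (_ : x ∈ U) (I : Fin (4 + k) → Fin m), c ^ 2 * nablaCurvature G k x I
      = evalTensor (nablaCurvature G' k (φ x)) (fun s => fderiv ℝ φ x (coordVec (I s)))
  | 0 => fun hx I => h.curvatureTensor hx I
  | k + 1 => fun hx I => h.covariantDeriv (h.metric.smooth_nablaCurvature k)
      (h.metric'.smooth_nablaCurvature k) (fun _ hy J => h.nablaCurvature k hy J) hx I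

end IsLocalHomothety

end Naturality

/-! ### The weight of complete contractions. -/

section Contractions

variable {m : ℕ}

local notation "𝔼" => EuclideanSpace ℝ (Fin m)

theorem prod_evalTensor {κ : Type*} [Fintype κ] [DecidableEq κ] {β : κ → Type*}
    [∀ a, Fintype (β a)] [∀ a, DecidableEq (β a)] (S : ∀ a, (β a → Fin m) → ℝ)
    (v : (Σ a, β a) → 𝔼) :
    ∏ a, evalTensor (S a) (fun s => v ⟨a, s⟩)
      = evalTensor (fun K : (Σ a, β a) → Fin m => ∏ a, S a fun s => K ⟨a, s⟩) v := by
  simp only [evalTensor_apply]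
  rw [Finset.prod_univ_sum, Fintype.piFinset_univ, ← (Equiv.piCurry fun _ _ => Fin m).sum_comp]
  refine Finset.sum_congr rfl fun K _ => ?_
  rw [Finset.prod_mul_distrib, Fintype.prod_sigma]
  rfl

/-- For fixed `K`, the sum over `J` factors over the `N` pairs, and `h` evaluates each factor,
contributing one `a`. -/
theorem sum_prod_mul_evalTensor {ι : Type*} [Fintype ι] [DecidableEq ι] {N : ℕ}
    (σ : Fin N × Fin 2 ≃ ι) {g g' : Matrix (Fin m) (Fin m) ℝ} {A : Fin m → 𝔼} {a : ℝ}
    (h : ∀ p q, ∑ i, ∑ j, g i j * (A i p * A j q) = a * g' p q) (S : (ι → Fin m) → ℝ) :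
    ∑ J : ι → Fin m, (∏ t, g (J (σ (t, 0))) (J (σ (t, 1)))) * evalTensor S (fun s => A (J s))
      = a ^ N * ∑ K : ι → Fin m, (∏ t, g' (K (σ (t, 0))) (K (σ (t, 1)))) * S K := by
  simp only [evalTensor_apply, Finset.mul_sum]
  rw [Finset.sum_comm]
  refine Finset.sum_congr rfl fun K _ => ?_
  have h1 : ∏ t, (a * g' (K (σ (t, 0))) (K (σ (t, 1))))
      = a ^ N * ∏ t, g' (K (σ (t, 0))) (K (σ (t, 1))) := by
    simp [Finset.prod_mul_distrib]
  simp only [← mul_assoc]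
  rw [← Finset.sum_mul, ← h1]
  congr 1
  simp only [← h]
  have h2 : ∀ p q, ∑ i, ∑ j, g i j * (A i p * A j q)
      = ∑ f : Fin 2 → Fin m, g (f 0) (f 1) * (A (f 0) p * A (f 1) q) := fun p q => by
    rw [← (finTwoArrowEquiv (Fin m)).symm.sum_comp, Fintype.sum_prod_type]
    simp
  simp only [h2]
  rw [Finset.prod_univ_sum, Fintype.piFinset_univ,
    ← ((σ.arrowCongr (Equiv.refl (Fin m))).symm.trans (Equiv.curry _ _ _)).symm.sum_comp]
  refine Finset.sum_congr rfl fun f _ => ?_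
  rw [Finset.prod_mul_distrib, ← σ.prod_comp, Fintype.prod_prod_type]
  simp [Equiv.arrowCongr, Function.uncurry]

theorem bilinForm_apply (B : Matrix (Fin m) (Fin m) ℝ) (u v : 𝔼) :
    bilinForm B u v = ∑ i, ∑ j, u i * B i j * v j := by
  conv_lhs => rw [← sum_smul_coordVec u, ← sum_smul_coordVec v]
  simp only [map_sum, map_smul, _root_.sum_apply, _root_.smul_apply, bilinForm_coordVec,
    smul_eq_mul, Finset.mul_sum]
  rw [Finset.sum_comm]
  exact Finset.sum_congr rfl fun i _ => Finset.sum_congr rfl fun j _ => by ring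

namespace IsLocalHomothety

variable {c : ℝ} {φ : EuclideanSpace ℝ (Fin m) → EuclideanSpace ℝ (Fin m)}
  {G G' : EuclideanSpace ℝ (Fin m) → Matrix (Fin m) (Fin m) ℝ}
  {U V : Set (EuclideanSpace ℝ (Fin m))}

/-- This is `Aᵀ G' A = c² G` inverted, with `A` the Jacobian matrix: `A G⁻¹ Aᵀ = c² G'⁻¹`. -/
theorem sum_inv (h : IsLocalHomothety c φ G G' U V) {x : 𝔼} (hx : x ∈ U) (p q : Fin m) :
    ∑ i, ∑ j, (G x)⁻¹ i j * (fderiv ℝ φ x (coordVec i) p * fderiv ℝ φ x (coordVec j) q)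
      = c ^ 2 * (G' (φ x))⁻¹ p q := by
  set A : Matrix (Fin m) (Fin m) ℝ := Matrix.of fun a i => fderiv ℝ φ x (coordVec i) a with hA
  have h1 : A.transpose * (G' (φ x)) * A = c ^ 2 • G x := by
    ext i j
    have := h.pull x hx (coordVec i) (coordVec j)
    rw [bilinForm_coordVec, bilinForm_apply, Finset.sum_comm] at this
    simpa [Matrix.mul_apply, Finset.sum_mul, hA] using this
  have hGu := h.metric.isUnit x hx
  have hG'u := h.metric'.isUnit _ (h.mapsTo hx)
  have hAu : IsUnit A.det := by
    have h2 := congrArg Matrix.det h1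
    rw [Matrix.det_mul, Matrix.det_smul] at h2
    refine isUnit_iff_ne_zero.2 fun h0 => ?_
    rw [h0, mul_zero] at h2
    exact mul_ne_zero (pow_ne_zero _ (pow_ne_zero 2 h.ne_zero)) hGu.ne_zero h2.symm
  have h3 : A * (G x)⁻¹ * A.transpose = c ^ 2 • (G' (φ x))⁻¹ := by
    have h4 : A * (G x)⁻¹ * A.transpose * G' (φ x) * A = c ^ 2 • A := by
      rw [Matrix.mul_assoc _ _ A, Matrix.mul_assoc _ A.transpose, ← Matrix.mul_assoc A.transpose,
        h1, Matrix.mul_smul, Matrix.mul_assoc, Matrix.nonsing_inv_mul _ hGu, Matrix.mul_one]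
    calc A * (G x)⁻¹ * A.transpose
        = A * (G x)⁻¹ * A.transpose * G' (φ x) * A * A⁻¹ * (G' (φ x))⁻¹ := by
          rw [Matrix.mul_nonsing_inv_cancel_right _ _ hAu,
            Matrix.mul_nonsing_inv_cancel_right _ _ hG'u]
      _ = _ := by
          rw [h4, Matrix.smul_mul, Matrix.mul_nonsing_inv _ hAu, Matrix.smul_mul, Matrix.one_mul]
  have h5 := congrFun (congrFun h3 p) q
  simp only [Matrix.mul_apply, Matrix.transpose_apply, hA, Matrix.of_apply, Matrix.smul_apply,
    smul_eq_mul, Finset.sum_mul] at h5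
  rw [← h5, Finset.sum_comm]
  exact Finset.sum_congr rfl fun i _ => Finset.sum_congr rfl fun j _ => by ring

theorem completeContraction (h : IsLocalHomothety c φ G G' U V) {r N : ℕ} (k : Fin r → ℕ)
    (σ : Fin N × Fin 2 ≃ (Σ a : Fin r, Fin (4 + k a))) {x : 𝔼} (hx : x ∈ U) :
    completeContraction G k σ x
      = c ^ (∑ a, (k a + 2)) * completeContraction G' k σ (φ x) := by
  -- The `N` pairs exhaust the `∑ (4 + kₐ)` slots. The excess of `2N` over the `2r` from the
  -- curvature factors is the order.
  have hN : 2 * N = 2 * r + ∑ a, (k a + 2) := by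
    have := Fintype.card_congr σ
    simp only [Fintype.card_prod, Fintype.card_fin, Fintype.card_sigma, Finset.sum_add_distrib,
      Finset.sum_const, Finset.card_univ, smul_eq_mul] at this ⊢
    omega
  have h1 := sum_prod_mul_evalTensor σ (h.sum_inv hx)
    (fun K => ∏ a, _root_.nablaCurvature G' (k a) (φ x) fun s => K ⟨a, s⟩)
  have h2 : ∀ J : (Σ a : Fin r, Fin (4 + k a)) → Fin m,
      evalTensor (fun K : (Σ a : Fin r, Fin (4 + k a)) → Fin m =>
        ∏ a, _root_.nablaCurvature G' (k a) (φ x) fun s => K ⟨a, s⟩)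
        (fun s => fderiv ℝ φ x (coordVec (J s)))
      = c ^ (2 * r) * ∏ a, _root_.nablaCurvature G (k a) x fun s => J ⟨a, s⟩ := by
    intro J
    rw [← prod_evalTensor (fun a => _root_.nablaCurvature G' (k a) (φ x))]
    simp only [← h.nablaCurvature _ hx fun s => J ⟨_, s⟩, Finset.prod_mul_distrib]
    simp [pow_mul]
  simp only [h2, mul_left_comm _ (c ^ (2 * r))] at h1
  rw [← Finset.mul_sum, ← pow_mul, hN, pow_add, mul_assoc] at h1
  exact mul_left_cancel₀ (pow_ne_zero _ h.ne_zero) h1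

end IsLocalHomothety

end Contractions

/-! ### Contractions on manifolds -/

section ManifoldContractions

variable {m : ℕ} {M : Type*} [TopologicalSpace M] [ChartedSpace (EuclideanSpace ℝ (Fin m)) M]
  [IsManifold (𝓡 m) ∞ M]

local notation "𝔼" => EuclideanSpace ℝ (Fin m)

theorem IsMetricOn.mono {G : 𝔼 → Matrix (Fin m) (Fin m) ℝ} {U V : Set 𝔼} (h : IsMetricOn G V)
    (hU : IsOpen U) (hUV : U ⊆ V) : IsMetricOn G U :=
  ⟨hU, fun i j => (h.smooth i j).mono hUV, fun x hx => h.symm x (hUV hx),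
    fun x hx => h.isUnit x (hUV hx)⟩

/-- The coordinate vector field is the tangent map of `e.symm` applied to a constant field; this
feeds the smoothness of the metric components. -/
theorem contMDiffOn_mfderiv_symm_chart {e : OpenPartialHomeomorph M 𝔼} (he : e ∈ atlas 𝔼 M)
    (v : 𝔼) : ContMDiffOn (𝓡 m) ((𝓡 m).prod 𝓘(ℝ, 𝔼)) ∞
      (fun x => (TotalSpace.mk' 𝔼 (E := fun p : M => TangentSpace (𝓡 m) p) (e.symm x)
        (mfderiv (𝓡 m) (𝓡 m) e.symm x v))) e.target := by
  have h1 : ContMDiffOn (𝓡 m) (𝓡 m) ∞ e.symm e.target :=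
    contMDiffOn_symm_of_mem_maximalAtlas (IsManifold.subset_maximalAtlas he)
  have h2 := h1.contMDiffOn_tangentMapWithin (m := ∞) (by simp) e.open_target.uniqueMDiffOn
  have h3 : ContMDiff (𝓡 m) ((𝓡 m).prod 𝓘(ℝ, 𝔼)) ∞
      (fun x : 𝔼 => (⟨x, v⟩ : TangentBundle (𝓡 m) 𝔼)) :=
    contMDiff_vectorSpace_iff_contDiff.2 contDiff_const
  refine (ContMDiffOn.comp (f := fun x : 𝔼 => (⟨x, v⟩ : TangentBundle (𝓡 m) 𝔼)) (s := e.target) h2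
    h3.contMDiffOn fun x hx => hx).congr fun x hx => ?_
  simp only [Function.comp_apply, tangentMapWithin, mfderivWithin_of_isOpen e.open_target hx]

namespace PseudoRiemannianMetric

variable (g : PseudoRiemannianMetric m M)

theorem bilinForm_inChart (e : OpenPartialHomeomorph M 𝔼) (x u v : 𝔼) :
    bilinForm (g.inChart e x) u v = g.val (e.symm x) (mfderiv (𝓡 m) (𝓡 m) e.symm x u)
      (mfderiv (𝓡 m) (𝓡 m) e.symm x v) := by
  have h : ∀ (B : 𝔼 →L[ℝ] 𝔼 →L[ℝ] ℝ) (L : 𝔼 →L[ℝ] 𝔼),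
      bilinForm (fun i j => B (L (coordVec i)) (L (coordVec j))) u v = B (L u) (L v) := fun B L => by
    have h1 : bilinForm (fun i j => B (L (coordVec i)) (L (coordVec j))) = B.bilinearComp L L :=
      (coordBasis m).bilin_ext fun i j => by
        rw [coordBasis_apply, coordBasis_apply]
        exact bilinForm_coordVec _ i j
    rw [h1]
    rfl
  exact h (g.val (e.symm x)) (mfderiv (𝓡 m) (𝓡 m) e.symm x)

theorem isMetricOn_inChart {e : OpenPartialHomeomorph M 𝔼} (he : e ∈ atlas 𝔼 M) :
    IsMetricOn (g.inChart e) e.target where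
  isOpen := e.open_target
  smooth i j := by
    rw [← contMDiffOn_iff_contDiffOn]
    have h1 : ContMDiffOn (𝓡 m) (𝓡 m) ∞ e.symm e.target :=
      contMDiffOn_symm_of_mem_maximalAtlas (IsManifold.subset_maximalAtlas he)
    have h2 := ContMDiffOn.clm_bundle_apply₂ (F₁ := 𝔼) (F₂ := 𝔼) (F₃ := ℝ)
      (E₃ := fun _ : M => ℝ) (b := e.symm)
      (g.contMDiff.comp_contMDiffOn h1) (contMDiffOn_mfderiv_symm_chart he (coordVec i))
      (contMDiffOn_mfderiv_symm_chart he (coordVec j))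
    exact fun x hx => ((contMDiffWithinAt_totalSpace).1 (h2 x hx)).2
  symm x _ i j := g.symm _ _ _
  isUnit x hx := by
    rw [isUnit_iff_ne_zero]
    intro h0
    obtain ⟨v, hv, hv'⟩ := Matrix.exists_vecMul_eq_zero_iff.2 h0
    set u : 𝔼 := WithLp.toLp 2 v with hu
    have hbij := (mdifferentiable_of_mem_atlas (I := 𝓡 m) he).symm.mfderiv_bijective hx
    have h1 : ∀ w, bilinForm (g.inChart e x) u w = 0 := by
      intro w
      rw [bilinForm_apply, Finset.sum_comm]
      refine Finset.sum_eq_zero fun j _ => ?_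
      have := congrFun hv' j
      simp only [Matrix.vecMul, dotProduct, Pi.zero_apply] at this
      rw [← Finset.sum_mul, hu]
      simp only [this, zero_mul]
    have h2 : mfderiv (𝓡 m) (𝓡 m) e.symm x u = 0 := g.nondegenerate _ _ fun w => by
      obtain ⟨w', rfl⟩ := hbij.2 w
      exact (g.bilinForm_inChart e x u w').symm.trans (h1 w')
    have h3 : u = 0 := hbij.1 (h2.trans (map_zero (mfderiv (𝓡 m) (𝓡 m) e.symm x)).symm)
    exact hv (congrArg WithLp.ofLp h3)

variable {g}

theorem PullsBackTo.isLocalHomothety {T : Equiv.Perm M} {c : ℝ} (hc : 0 < c)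
    (hT : ContMDiff (𝓡 m) (𝓡 m) ∞ T) (h : g.PullsBackTo T c) {e e' : OpenPartialHomeomorph M 𝔼}
    (he : e ∈ atlas 𝔼 M) (he' : e' ∈ atlas 𝔼 M) :
    IsLocalHomothety c (e' ∘ T ∘ e.symm) (g.inChart e) (g.inChart e')
      (e.target ∩ e.symm ⁻¹' (T ⁻¹' e'.source)) e'.target := by
  have hopen : IsOpen (e.target ∩ e.symm ⁻¹' (T ⁻¹' e'.source)) :=
    e.symm.isOpen_inter_preimage (e'.open_source.preimage hT.continuous)
  have hes : ContMDiffOn (𝓡 m) (𝓡 m) ∞ e.symm e.target :=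
    contMDiffOn_symm_of_mem_maximalAtlas (IsManifold.subset_maximalAtlas he)
  have hes' : ContMDiffOn (𝓡 m) (𝓡 m) ∞ e' e'.source :=
    contMDiffOn_of_mem_maximalAtlas (IsManifold.subset_maximalAtlas he')
  have hφ : ContMDiffOn (𝓡 m) (𝓡 m) ∞ (e' ∘ T ∘ e.symm)
      (e.target ∩ e.symm ⁻¹' (T ⁻¹' e'.source)) :=
    hes'.comp (hT.comp_contMDiffOn (hes.mono inter_subset_left)) fun x hx => hx.2
  refine ⟨(g.isMetricOn_inChart he).mono hopen inter_subset_left, g.isMetricOn_inChart he',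
    contMDiffOn_iff_contDiffOn.1 hφ, fun x hx => e'.map_source hx.2, hc.ne', fun x hx u v => ?_⟩
  set φ := e' ∘ T ∘ e.symm with hφdef
  have hx' : φ x ∈ e'.target := e'.map_source hx.2
  have hback : e'.symm (φ x) = T (e.symm x) := e'.left_inv hx.2
  have hde' : MDifferentiableAt (𝓡 m) (𝓡 m) e'.symm (φ x) := mdifferentiableAt_atlas_symm he' hx'
  have hde : MDifferentiableAt (𝓡 m) (𝓡 m) e.symm x := mdifferentiableAt_atlas_symm he hx.1
  have hdφ : MDifferentiableAt (𝓡 m) (𝓡 m) φ x :=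
    (hφ.contMDiffAt (hopen.mem_nhds hx)).mdifferentiableAt (by simp)
  have hdT : MDifferentiableAt (𝓡 m) (𝓡 m) T (e.symm x) := hT.mdifferentiable (by simp) _
  -- Chain rule on both sides of `e'.symm ∘ φ = T ∘ e.symm`, valid near `x`.
  have hderiv : ∀ w : 𝔼, mfderiv (𝓡 m) (𝓡 m) e'.symm (φ x) (fderiv ℝ φ x w)
      = mfderiv (𝓡 m) (𝓡 m) T (e.symm x) (mfderiv (𝓡 m) (𝓡 m) e.symm x w) := by
    intro w
    have h1 := mfderiv_comp x hde' hdφ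
    have h2 := mfderiv_comp x hdT hde
    have h3 : e'.symm ∘ φ =ᶠ[𝓝 x] T ∘ e.symm :=
      eventually_of_mem (hopen.mem_nhds hx) fun y hy => e'.left_inv hy.2
    rw [h3.mfderiv_eq] at h1
    have h4 := congrArg (fun f => f w) (h1.symm.trans h2)
    rw [mfderiv_eq_fderiv] at h4
    exact h4
  rw [bilinForm_inChart, bilinForm_inChart, hderiv, hderiv, ← h]
  rw [hback]

/-- The charts are arbitrary, so that `T = 1`, `c = 1` yields invariance under change of chart. -/
theorem PullsBackTo.completeContraction {T : Equiv.Perm M} {c : ℝ} (hc : 0 < c)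
    (hT : ContMDiff (𝓡 m) (𝓡 m) ∞ T) (h : g.PullsBackTo T c) {e e' : OpenPartialHomeomorph M 𝔼}
    (he : e ∈ atlas 𝔼 M) (he' : e' ∈ atlas 𝔼 M) {r N : ℕ} (k : Fin r → ℕ)
    (σ : Fin N × Fin 2 ≃ (Σ a : Fin r, Fin (4 + k a))) {p : M} (hp : p ∈ e.source)
    (hp' : T p ∈ e'.source) :
    completeContraction (g.inChart e) k σ (e p)
      = c ^ (∑ a, (k a + 2)) * completeContraction (g.inChart e') k σ (e' (T p)) := by
  have h1 := (h.isLocalHomothety hc hT he he').completeContraction k σ (x := e p)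
    ⟨e.map_source hp, by simpa [e.left_inv hp] using hp'⟩
  simpa [e.left_inv hp] using h1

theorem PullsBackTo.contraction {T : Equiv.Perm M} {c : ℝ} (hc : 0 < c)
    (hT : ContMDiff (𝓡 m) (𝓡 m) ∞ T) (h : g.PullsBackTo T c) {r N : ℕ} (k : Fin r → ℕ)
    (σ : Fin N × Fin 2 ≃ (Σ a : Fin r, Fin (4 + k a))) (p : M) :
    g.contraction k σ p = c ^ (∑ a, (k a + 2)) * g.contraction k σ (T p) :=
  h.completeContraction hc hT (chart_mem_atlas _ p) (chart_mem_atlas _ (T p)) k σ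
    (mem_chart_source _ p) (mem_chart_source _ (T p))

variable (g)

theorem contMDiff_contraction {r N : ℕ} (k : Fin r → ℕ)
    (σ : Fin N × Fin 2 ≃ (Σ a : Fin r, Fin (4 + k a))) :
    ContMDiff (𝓡 m) 𝓘(ℝ, ℝ) ∞ (g.contraction k σ) := by
  intro p
  set e := chartAt 𝔼 p with he
  have he' : e ∈ atlas 𝔼 M := chart_mem_atlas _ p
  have h1 : ContMDiffOn (𝓡 m) 𝓘(ℝ, ℝ) ∞ (fun q => completeContraction (g.inChart e) k σ (e q))
      e.source :=
    (contMDiffOn_iff_contDiffOn.2 ((g.isMetricOn_inChart he').smooth_completeContraction k σ)).comp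
      (contMDiffOn_of_mem_maximalAtlas (IsManifold.subset_maximalAtlas he')) e.mapsTo
  have hp : e.source ∈ 𝓝 p := e.open_source.mem_nhds (mem_chart_source _ p)
  refine (h1.contMDiffAt hp).congr_of_eventuallyEq (eventually_of_mem hp fun q hq => ?_)
  -- `contraction` uses a different chart at each `q`; the identity map transfers it to the fixed
  -- chart `e`.
  have := (PullsBackTo.one g).completeContraction one_pos contMDiff_id
    (chart_mem_atlas _ q) he' k σ (mem_chart_source _ q) hq
  simpa [contraction] using this

/-- Weyl scalar invariants are smooth. -/
theorem contMDiff_weylInvariant {ℓ : ℕ} {F : M → ℝ} (hF : F ∈ g.weylInvariants ℓ) :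
    ContMDiff (𝓡 m) 𝓘(ℝ, ℝ) ∞ F := by
  induction hF using Submodule.span_induction with
  | mem F hF =>
    obtain ⟨r, N, k, σ, _, _, rfl⟩ := hF
    exact g.contMDiff_contraction k σ
  | zero => exact contMDiff_const
  | add F F' _ _ h h' => exact h.add h'
  | smul a F _ h => exact contMDiff_const.mul h

variable {g}

/-- Weyl scalar invariants of order `ℓ` have weight `-ℓ` under homotheties. -/
theorem PullsBackTo.weylInvariant {T : Equiv.Perm M} {c : ℝ} (hc : 0 < c)
    (hT : ContMDiff (𝓡 m) (𝓡 m) ∞ T) (h : g.PullsBackTo T c) {ℓ : ℕ} {F : M → ℝ}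
    (hF : F ∈ g.weylInvariants ℓ) (p : M) : F p = c ^ ℓ * F (T p) := by
  induction hF using Submodule.span_induction with
  | mem F hF =>
    obtain ⟨r, N, k, σ, _, rfl, rfl⟩ := hF
    exact h.contraction hc hT k σ p
  | zero => simp
  | add F F' _ _ h h' => simp [h, h', mul_add]
  | smul a F _ h => simp [h, mul_left_comm]

/-- There is at least one factor and each adds at least 2 to the order, so nothing spans order 0.
This guarantees `ℓ ≠ 0` when the `ℓ`-th root is taken. -/
theorem weylInvariant_eq_zero_of_order_eq_zero {F : M → ℝ} (hF : F ∈ g.weylInvariants 0) :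
    F = 0 := by
  induction hF using Submodule.span_induction with
  | mem F hF =>
    obtain ⟨r, N, k, σ, hr, h0, _⟩ := hF
    simp only [Finset.sum_eq_zero_iff, Finset.mem_univ, forall_const] at h0
    have := h0 ⟨0, hr⟩
    omega
  | zero => rfl
  | add F F' _ _ h h' => rw [h, h', add_zero]
  | smul a F _ h => rw [h, smul_zero]

end PseudoRiemannianMetric

end ManifoldContractions

/-! ### Regular level sets -/

section LevelSets

variable {m : ℕ}

local notation "𝔼" => EuclideanSpace ℝ (Fin m)

/-- Near a regular point, a function can be completed to a smooth coordinate system, as its last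
coordinate. -/
theorem exists_openPartialHomeomorph_last_eq (l : Fin m) {F : 𝔼 → ℝ} {U : Set 𝔼} (hU : IsOpen U)
    (hF : ContDiffOn ℝ ∞ F U) {x : 𝔼} (hx : x ∈ U) (hreg : fderiv ℝ F x ≠ 0) :
    ∃ ρ : OpenPartialHomeomorph 𝔼 𝔼, x ∈ ρ.source ∧ ρ.source ⊆ U ∧
      ContDiffOn ℝ ∞ ρ ρ.source ∧ ContDiffOn ℝ ∞ ρ.symm ρ.target ∧
      ∀ y ∈ ρ.source, ρ y l = F y := by
  obtain ⟨i, hi⟩ : ∃ i, fderiv ℝ F x (coordVec i) ≠ 0 := by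
    by_contra! h
    refine hreg (ContinuousLinearMap.coe_injective <| (coordBasis m).ext fun i => ?_)
    rw [coordBasis_apply]
    simpa using h i
  -- `F` takes slot `l`, replacing the coordinate `yᵢ` along which it has nonzero derivative; the
  -- swap moves `y_l` to slot `i`.
  set ψ : 𝔼 → 𝔼 := fun y => WithLp.toLp 2 fun j => if j = l then F y else y (Equiv.swap i l j)
    with hψ
  have hψs : ContDiffOn ℝ ∞ ψ U := by
    rw [contDiffOn_piLp]
    intro j
    by_cases hj : j = l
    · simpa [hψ, hj] using hF
    · simpa [hψ, hj] using
        (EuclideanSpace.proj (Equiv.swap i l j) : 𝔼 →L[ℝ] ℝ).contDiff.contDiffOn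
  have hψx : ContDiffAt ℝ ∞ ψ x := hψs.contDiffAt (hU.mem_nhds hx)
  have hFx : DifferentiableAt ℝ F x := (hF.contDiffAt (hU.mem_nhds hx)).differentiableAt (by simp)
  have hL : ∀ v j, fderiv ℝ ψ x v j = if j = l then fderiv ℝ F x v else v (Equiv.swap i l j) := by
    intro v j
    have h1 : HasFDerivAt (fun y => ψ y j) ((EuclideanSpace.proj j).comp (fderiv ℝ ψ x)) x :=
      (EuclideanSpace.proj j : 𝔼 →L[ℝ] ℝ).hasFDerivAt.comp x
        (hψx.differentiableAt (by simp)).hasFDerivAt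
    by_cases hj : j = l
    · have h2 : HasFDerivAt (fun y => ψ y j) (fderiv ℝ F x) x := by
        simpa [hψ, hj] using hFx.hasFDerivAt
      simpa [hj] using congrArg (fun f => f v) (h1.unique h2)
    · have h2 : HasFDerivAt (fun y => ψ y j)
          (EuclideanSpace.proj (Equiv.swap i l j) : 𝔼 →L[ℝ] ℝ) x := by
        simpa [hψ, hj] using (EuclideanSpace.proj (Equiv.swap i l j) : 𝔼 →L[ℝ] ℝ).hasFDerivAt
      simpa [hj] using congrArg (fun f => f v) (h1.unique h2)
  have hinj : Function.Injective (fderiv ℝ ψ x : 𝔼 →ₗ[ℝ] 𝔼) := by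
    refine (injective_iff_map_eq_zero _).2 fun v hv => ?_
    have hv' : ∀ j, (if j = l then fderiv ℝ F x v else v (Equiv.swap i l j)) = 0 := fun j => by
      rw [← hL]
      exact congrArg (fun w : 𝔼 => w j) hv
    have h1 : ∀ j, j ≠ i → v j = 0 := by
      intro j hj
      have h2 := hv' (Equiv.swap i l j)
      rw [if_neg, Equiv.swap_apply_self] at h2
      · exact h2
      · intro h3
        rw [Equiv.swap_apply_eq_iff, Equiv.swap_apply_right] at h3
        exact hj h3
    have h2 : v = v i • coordVec i := by
      conv_lhs => rw [← sum_smul_coordVec v]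
      exact Finset.sum_eq_single i (fun j _ hj => by rw [h1 j hj, zero_smul]) (by simp)
    have h3 := hv' l
    rw [if_pos rfl, h2, map_smul, smul_eq_mul, mul_eq_zero] at h3
    rw [h2, h3.resolve_right hi, zero_smul]
  set L : 𝔼 ≃L[ℝ] 𝔼 :=
    (LinearEquiv.ofInjectiveEndo (fderiv ℝ ψ x : 𝔼 →ₗ[ℝ] 𝔼) hinj).toContinuousLinearEquiv with hLdef
  have hLψ : (L : 𝔼 →L[ℝ] 𝔼) = fderiv ℝ ψ x := by
    ext1 v
    rfl
  have hψL : HasFDerivAt ψ (L : 𝔼 →L[ℝ] 𝔼) x := by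
    rw [hLψ]
    exact (hψx.differentiableAt (by simp)).hasFDerivAt
  -- Restricting to points where `dψ` is invertible makes the inverse smooth on the whole target.
  set Ω : Set 𝔼 := U ∩ fderiv ℝ ψ ⁻¹' range ((↑) : (𝔼 ≃L[ℝ] 𝔼) → 𝔼 →L[ℝ] 𝔼) with hΩ
  have hΩo : IsOpen Ω := (hψs.continuousOn_fderiv_of_isOpen hU (by simp)).isOpen_inter_preimage hU
    ContinuousLinearEquiv.isOpen
  set ρ := (hψx.toOpenPartialHomeomorph ψ hψL (by simp)).restrOpen Ω hΩo with hρ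
  have hρs : ρ.source ⊆ Ω := fun y hy => hy.2
  have hρψ : ∀ y, ρ y = ψ y := fun y => rfl
  refine ⟨ρ, ⟨hψx.mem_toOpenPartialHomeomorph_source hψL (by simp), hx, L, hLψ⟩,
    fun y hy => (hρs hy).1, hψs.mono fun y hy => (hρs hy).1, fun y hy => ?_, fun y _ => ?_⟩
  · have h1 := hρs (ρ.map_target hy)
    obtain ⟨L', hL'⟩ := h1.2
    have h2 : ContDiffAt ℝ ∞ ψ (ρ.symm y) := hψs.contDiffAt (hU.mem_nhds h1.1)
    have h3 : HasFDerivAt ρ (L' : 𝔼 →L[ℝ] 𝔼) (ρ.symm y) := by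
      rw [hL']
      exact (h2.differentiableAt (by simp)).hasFDerivAt
    exact (ρ.contDiffAt_symm hy h3 h2).contDiffWithinAt
  · simp [hρψ, hψ]

variable {M : Type*} [TopologicalSpace M] [ChartedSpace (EuclideanSpace ℝ (Fin m)) M]
  [IsManifold (𝓡 m) ∞ M]

theorem mfderiv_apply_eq_fderiv_chart {f : M → ℝ} {e : OpenPartialHomeomorph M 𝔼}
    (he : e ∈ atlas 𝔼 M) {p : M} (hp : p ∈ e.source)
    (hf : MDifferentiableAt (𝓡 m) 𝓘(ℝ, ℝ) f p) (v : TangentSpace (𝓡 m) p) :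
    mfderiv (𝓡 m) 𝓘(ℝ, ℝ) f p v
      = fderiv ℝ (f ∘ e.symm) (e p) (mfderiv (𝓡 m) (𝓡 m) e p v) := by
  have h1 : MDifferentiableAt (𝓡 m) 𝓘(ℝ, ℝ) (f ∘ e.symm) (e p) := by
    refine MDifferentiableAt.comp _ ?_ (mdifferentiableAt_atlas_symm he (e.map_source hp))
    rwa [e.left_inv hp]
  have h2 := mfderiv_comp p h1 (mdifferentiableAt_atlas he hp)
  have h3 : f =ᶠ[𝓝 p] (f ∘ e.symm) ∘ e :=
    eventually_of_mem (e.open_source.mem_nhds hp) fun q hq => by simp [e.left_inv hq]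
  rw [← h3.mfderiv_eq, mfderiv_eq_fderiv] at h2
  exact congrArg (fun f => f v) h2

/-- The function is constant on chart balls, hence locally constant, and `M` is connected. -/
theorem eq_of_mfderiv_eq_zero [ConnectedSpace M] {f : M → ℝ}
    (hf : ContMDiff (𝓡 m) 𝓘(ℝ, ℝ) ∞ f) (h0 : ∀ p, mfderiv (𝓡 m) 𝓘(ℝ, ℝ) f p = 0) (p q : M) :
    f p = f q := by
  refine IsLocallyConstant.apply_eq_of_isPreconnected ((IsLocallyConstant.iff_eventually_eq _).2
    fun p => ?_) isPreconnected_univ (mem_univ p) (mem_univ q)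
  set e := chartAt 𝔼 p with he
  have he' : e ∈ atlas 𝔼 M := chart_mem_atlas _ p
  have hpe : p ∈ e.source := mem_chart_source _ p
  have hF : ContDiffOn ℝ ∞ (f ∘ e.symm) e.target := contMDiffOn_iff_contDiffOn.1
    (hf.comp_contMDiffOn (contMDiffOn_symm_of_mem_maximalAtlas (IsManifold.subset_maximalAtlas he')))
  have h1 : ∀ x ∈ e.target, fderiv ℝ (f ∘ e.symm) x = 0 := by
    intro x hx
    have hxs := e.map_target hx
    ext1 w
    obtain ⟨v, hv⟩ := (mdifferentiable_of_mem_atlas (I := 𝓡 m) he').mfderiv_surjective hxs w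
    have h2 := mfderiv_apply_eq_fderiv_chart he' hxs (hf.mdifferentiable (by simp) _) v
    rw [h0, e.right_inv hx] at h2
    rw [← hv]
    exact h2.symm
  obtain ⟨r, hr, hball⟩ := Metric.isOpen_iff.1 e.open_target (e p) (e.map_source hpe)
  filter_upwards [e.open_source.mem_nhds hpe, e.continuousAt hpe (Metric.ball_mem_nhds _ hr)]
    with q hq hq'
  have h3 := (convex_ball (e p) r).is_const_of_fderivWithin_eq_zero (𝕜 := ℝ)
    ((hF.differentiableOn (by simp)).mono hball) (fun x hx => by
      rw [fderivWithin_of_isOpen Metric.isOpen_ball hx, h1 x (hball hx)]) hq'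
      (Metric.mem_ball_self hr)
  simpa [e.left_inv hq, e.left_inv hpe] using h3

theorem ContMDiff.isSmoothSubmanifold_level {f : M → ℝ} (hf : ContMDiff (𝓡 m) 𝓘(ℝ, ℝ) ∞ f)
    (hm : 1 ≤ m) {c : ℝ} (hreg : ∀ p, f p = c → mfderiv (𝓡 m) 𝓘(ℝ, ℝ) f p ≠ 0) :
    IsSmoothSubmanifold m 1 {p | f p = c} := by
  refine ⟨hm, fun p hp => ?_⟩
  set e := chartAt 𝔼 p with he
  have he' : e ∈ IsManifold.maximalAtlas (𝓡 m) ∞ M := IsManifold.chart_mem_maximalAtlas p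
  have hpe : p ∈ e.source := mem_chart_source _ p
  set F : 𝔼 → ℝ := fun x => f (e.symm x) - c with hFdef
  have hF : ContDiffOn ℝ ∞ F e.target :=
    (contMDiffOn_iff_contDiffOn.1
      (hf.comp_contMDiffOn (contMDiffOn_symm_of_mem_maximalAtlas he'))).sub contDiffOn_const
  have hF0 : fderiv ℝ F (e p) ≠ 0 := by
    intro h0
    have h1 : fderiv ℝ (f ∘ e.symm) (e p) = 0 := by
      rw [← h0, hFdef, fderiv_sub_const]
      rfl
    refine hreg p hp (ContinuousLinearMap.ext fun v => ?_)
    rw [mfderiv_apply_eq_fderiv_chart (chart_mem_atlas _ p) hpe (hf.mdifferentiable (by simp) _), h1]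
    rfl
  -- `m - 1` is the only index `i` with `m ≤ i + 1`, as codimension 1 requires.
  obtain ⟨ρ, hxρ, hρe, hρ, hρ', hρF⟩ := exists_openPartialHomeomorph_last_eq ⟨m - 1, by omega⟩
    e.open_target hF (e.map_source hpe) hF0
  refine ⟨e.trans ρ, ?_, ?_, fun q hq => ?_⟩
  · refine OpenPartialHomeomorph.mem_maximalAtlas_of_contMDiffOn _ ?_ ?_
    · rw [OpenPartialHomeomorph.coe_trans]
      exact (contMDiffOn_iff_contDiffOn.2 hρ).comp
        ((contMDiffOn_of_mem_maximalAtlas he').mono fun q hq => by simp_all) fun q hq => by simp_all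
    · rw [OpenPartialHomeomorph.coe_trans_symm]
      exact (contMDiffOn_symm_of_mem_maximalAtlas he').comp
        ((contMDiffOn_iff_contDiffOn.2 hρ').mono fun q hq => by simp_all) fun q hq => by simp_all
  · simp [hpe, hxρ]
  · have hq' : q ∈ e.source ∧ e q ∈ ρ.source := by simpa using hq
    have h1 : (e.trans ρ) q ⟨m - 1, by omega⟩ = f q - c := by
      rw [OpenPartialHomeomorph.coe_trans, Function.comp_apply, hρF _ hq'.2, hFdef]
      simp only [e.left_inv hq'.1]
    constructor
    · intro h i hi
      rw [show i = ⟨m - 1, by omega⟩ from Fin.ext (by simp; omega), h1, sub_eq_zero]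
      exact h
    · intro h
      have := h ⟨m - 1, by omega⟩ (by simp; omega)
      rw [h1, sub_eq_zero] at this
      exact this

end LevelSets

/-! ### The Riemannian distance -/

/-- Compactness of the unit sphere gives `δ‖v‖² ≤ B v v`. The radius `1 + δ⁻¹` follows from `2‖v‖ ≤
1 + ‖v‖²` and avoids a square root. -/
theorem isVonNBounded_of_pos {F : Type*} [NormedAddCommGroup F] [NormedSpace ℝ F]
    [FiniteDimensional ℝ F] (B : F →L[ℝ] F →L[ℝ] ℝ) (hB : ∀ v, v ≠ 0 → 0 < B v v) :
    Bornology.IsVonNBounded ℝ {v : F | B v v < 1} := by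
  have hc : Continuous fun v : F => B v v := by fun_prop
  obtain ⟨δ, hδ, h⟩ := (isCompact_sphere (0 : F) 1).exists_forall_le' hc.continuousOn (a := 0)
    fun v hv => hB v (ne_zero_of_mem_unit_sphere ⟨v, hv⟩)
  refine NormedSpace.isVonNBounded_of_isBounded ℝ
    ((Metric.isBounded_closedBall (x := (0 : F)) (r := 1 + δ⁻¹)).subset fun v hv => ?_)
  rw [mem_closedBall_zero_iff]
  rcases eq_or_ne v 0 with rfl | hv0
  · rw [norm_zero]; positivity
  have hn : 0 < ‖v‖ := norm_pos_iff.2 hv0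
  have h1 := h (‖v‖⁻¹ • v) (by simp [norm_smul, hn.ne'])
  simp only [map_smul, _root_.smul_apply, smul_eq_mul] at h1
  have h2 : δ * ‖v‖ ^ 2 ≤ B v v := by
    calc δ * ‖v‖ ^ 2 ≤ ‖v‖⁻¹ * (‖v‖⁻¹ * B v v) * ‖v‖ ^ 2 := by gcongr
      _ = B v v := by field_simp
  have h3 : ‖v‖ ^ 2 ≤ δ⁻¹ := by
    rw [← one_div, le_div_iff₀ hδ, mul_comm]
    exact h2.trans (le_of_lt hv)
  nlinarith [sq_nonneg (‖v‖ - 1)]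

section RiemannianDistance

variable {m : ℕ} {M : Type*} [TopologicalSpace M] [ChartedSpace (EuclideanSpace ℝ (Fin m)) M]
  [IsManifold (𝓡 m) ∞ M]

local notation "𝔼" => EuclideanSpace ℝ (Fin m)

namespace PseudoRiemannianMetric

variable {g : PseudoRiemannianMetric m M}

/-- A Riemannian metric as an inner product on the tangent bundle. -/
noncomputable def IsRiemannian.toMetric (hg : g.IsRiemannian) :
    ContMDiffRiemannianMetric (𝓡 m) ∞ (EuclideanSpace ℝ (Fin m))
      (fun p : M => TangentSpace (𝓡 m) p) where
  inner := g.val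
  symm := g.symm
  pos := hg
  isVonNBounded p := isVonNBounded_of_pos (F := EuclideanSpace ℝ (Fin m)) (g.val p) (hg p)
  contMDiff := g.contMDiff

/-- The inner products on the tangent spaces given by a Riemannian metric. -/
@[reducible] noncomputable def IsRiemannian.toBundle (hg : g.IsRiemannian) :
    RiemannianBundle (fun p : M => TangentSpace (𝓡 m) p) :=
  ⟨hg.toMetric.toRiemannianMetric⟩

theorem IsRiemannian.enorm_eq (hg : g.IsRiemannian) (p : M) (v : TangentSpace (𝓡 m) p) :
    letI := hg.toBundle
    ‖v‖ₑ = ENNReal.ofReal (Real.sqrt (g.val p v v)) := by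
  let := hg.toBundle
  rw [← ofReal_norm, norm_eq_sqrt_real_inner]
  rfl

/-- The two norms on tangent spaces agree, so the general theory of `riemannianEDist` applies to
`g.edist`. -/
theorem IsRiemannian.edist_eq (hg : g.IsRiemannian) (p q : M) :
    letI := hg.toBundle
    g.edist p q = riemannianEDist (𝓡 m) p q := by
  let := hg.toBundle
  have h : (fun x : M => (⟨fun v => ENNReal.ofReal (Real.sqrt (g.val x v v))⟩ :
      ENorm (TangentSpace (𝓡 m) x))) = fun x : M => ⟨fun v => ‖v‖ₑ⟩ := by
    funext x
    congr 1
    funext v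
    exact (hg.enorm_eq x v).symm
  exact congrArg (fun i : ∀ x : M, ENorm (TangentSpace (𝓡 m) x) =>
    @riemannianEDist 𝔼 _ _ 𝔼 _ (𝓡 m) M _ _ i p q) h

theorem IsRiemannian.isContinuousRiemannianBundle (hg : g.IsRiemannian) :
    letI := hg.toBundle
    IsContinuousRiemannianBundle (EuclideanSpace ℝ (Fin m))
      (fun p : M => TangentSpace (𝓡 m) p) := by
  let := hg.toBundle
  exact ⟨⟨g.val, g.contMDiff.continuous, fun _ _ _ => rfl⟩⟩

theorem IsRiemannian.edist_self (hg : g.IsRiemannian) (p : M) : g.edist p p = 0 := by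
  let := hg.toBundle
  rw [hg.edist_eq]
  exact riemannianEDist_self

theorem IsRiemannian.edist_comm (hg : g.IsRiemannian) (p q : M) : g.edist p q = g.edist q p := by
  let := hg.toBundle
  rw [hg.edist_eq, hg.edist_eq]
  exact riemannianEDist_comm

theorem IsRiemannian.edist_triangle (hg : g.IsRiemannian) (p q r : M) :
    g.edist p r ≤ g.edist p q + g.edist q r := by
  let := hg.toBundle
  rw [hg.edist_eq, hg.edist_eq, hg.edist_eq]
  exact riemannianEDist_triangle

theorem IsRiemannian.exists_edist_lt_subset [T2Space M] (hg : g.IsRiemannian) {p : M} {s : Set M}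
    (hs : s ∈ 𝓝 p) : ∃ c > 0, ∀ q, g.edist p q < c → q ∈ s := by
  let := hg.toBundle
  have : LocallyCompactSpace M := ChartedSpace.locallyCompactSpace 𝔼 M
  have := hg.isContinuousRiemannianBundle
  simp only [hg.edist_eq]
  exact setOfPred_riemannianEDist_lt_subset_nhds' (𝓡 m) hs

theorem IsRiemannian.eventually_edist_lt (hg : g.IsRiemannian) (p : M) {c : ℝ≥0∞} (hc : 0 < c) :
    ∀ᶠ q in 𝓝 p, g.edist p q < c := by
  let := hg.toBundle
  have := hg.isContinuousRiemannianBundle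
  simp only [hg.edist_eq]
  exact eventually_riemannianEDist_lt (𝓡 m) p hc

/-- The points at finite distance from `p` form a nonempty clopen set. -/
theorem IsRiemannian.edist_ne_top [ConnectedSpace M] (hg : g.IsRiemannian) (p q : M) :
    g.edist p q ≠ ⊤ := by
  have h1 : IsClopen {q | g.edist p q ≠ ⊤} := by
    refine ⟨⟨isOpen_iff_mem_nhds.2 fun r hr => ?_⟩, isOpen_iff_mem_nhds.2 fun r hr => ?_⟩
    · filter_upwards [hg.eventually_edist_lt r one_pos] with s hs
      simp only [mem_compl_iff, mem_ofPred_eq, not_not] at hr ⊢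
      by_contra h
      have h2 := hg.edist_triangle p s r
      rw [hr, top_le_iff, ENNReal.add_eq_top, hg.edist_comm s] at h2
      exact h2.elim h (hs.trans ENNReal.one_lt_top).ne
    · filter_upwards [hg.eventually_edist_lt r one_pos] with s hs
      exact ne_top_of_le_ne_top (ENNReal.add_ne_top.2 ⟨hr, (hs.trans ENNReal.one_lt_top).ne⟩)
        (hg.edist_triangle p r s)
  have h2 := h1.eq_univ ⟨p, by simp [hg.edist_self]⟩
  exact (h2 ▸ mem_univ q : q ∈ {q | g.edist p q ≠ ⊤})

/-- A short curve crosses all intermediate levels of a continuous function. -/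
theorem IsRiemannian.exists_edist_add_edist_lt (hg : g.IsRiemannian) {f : M → ℝ}
    (hf : Continuous f) {p q : M} {r : ℝ≥0∞} (h : g.edist p q < r) {d : ℝ} (hp : f p ≤ d)
    (hq : d ≤ f q) : ∃ z, f z = d ∧ g.edist p z + g.edist z q < r := by
  let := hg.toBundle
  simp only [hg.edist_eq] at h ⊢
  obtain ⟨γ, h0, h1, hγ, hlen⟩ := exists_lt_of_riemannianEDist_lt h
  subst h0 h1
  obtain ⟨t, ht, htd⟩ := intermediate_value_Icc zero_le_one (hf.comp_continuousOn hγ.continuousOn)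
    ⟨hp, hq⟩
  refine ⟨γ t, htd, lt_of_le_of_lt ?_ hlen⟩
  rw [← pathELength_add ht.1 ht.2]
  exact add_le_add
    (riemannianEDist_le_pathELength (hγ.mono (Icc_subset_Icc_right ht.2)) rfl rfl ht.1)
    (riemannianEDist_le_pathELength (hγ.mono (Icc_subset_Icc_left ht.1)) rfl rfl ht.2)

/-- Composition with `T` multiplies the length of every curve by `c`. -/
theorem PullsBackTo.edist_le (hg : g.IsRiemannian) {T : Equiv.Perm M} {c : ℝ} (hc : 0 < c)
    (hT : ContMDiff (𝓡 m) (𝓡 m) ∞ T) (h : g.PullsBackTo T c) (p q : M) :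
    g.edist (T p) (T q) ≤ ENNReal.ofReal c * g.edist p q := by
  let := hg.toBundle
  have hc0 : ENNReal.ofReal c ≠ 0 := by simpa using hc
  rw [mul_comm, ← ENNReal.div_le_iff_le_mul (.inl hc0) (.inl ENNReal.ofReal_ne_top)]
  refine le_of_forall_gt fun r hr => ?_
  rw [hg.edist_eq] at hr
  obtain ⟨γ, rfl, rfl, hγ, hlen⟩ := exists_lt_of_riemannianEDist_lt hr
  refine lt_of_le_of_lt ?_ hlen
  rw [ENNReal.div_le_iff_le_mul (.inl hc0) (.inl ENNReal.ofReal_ne_top), hg.edist_eq]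
  refine (riemannianEDist_le_pathELength (γ := T ∘ γ)
    ((hT.of_le (by simp)).comp_contMDiffOn hγ) rfl rfl zero_le_one).trans ?_
  simp only [pathELength_eq_lintegral_mfderivWithin_Icc]
  rw [← MeasureTheory.lintegral_mul_const' _ _ ENNReal.ofReal_ne_top]
  refine MeasureTheory.setLIntegral_mono_ae' measurableSet_Icc (Eventually.of_forall fun t ht => ?_)
  have hu : UniqueMDiffWithinAt 𝓘(ℝ, ℝ) (Icc (0 : ℝ) 1) t :=
    (uniqueDiffOn_Icc zero_lt_one t ht).uniqueMDiffWithinAt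
  have h1 := mfderiv_comp_mfderivWithin t (hT.mdifferentiable (by simp) (γ t))
    ((hγ t ht).mdifferentiableWithinAt (by simp)) hu
  rw [h1]
  refine le_of_eq ?_
  rw [hg.enorm_eq, hg.enorm_eq]
  have h2 := h (γ t) (mfderivWithin 𝓘(ℝ, ℝ) (𝓡 m) γ (Icc 0 1) t 1)
    (mfderivWithin 𝓘(ℝ, ℝ) (𝓡 m) γ (Icc 0 1) t 1)
  refine (congrArg (fun s => ENNReal.ofReal (Real.sqrt s)) h2).trans ?_
  rw [Real.sqrt_mul (sq_nonneg c), Real.sqrt_sq hc.le, ENNReal.ofReal_mul hc.le, mul_comm]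

end PseudoRiemannianMetric

end RiemannianDistance

/-! ### Functions of weight one under homotheties -/

theorem PseudoRiemannianMetric.muFun_self {M : Type*} {F : M → ℝ} {P₀ : M} (hF : F P₀ ≠ 0) (ℓ : ℕ) :
    muFun F ℓ P₀ P₀ = 1 := by
  simp [muFun, hF]

section Gauge

variable {m : ℕ} {M : Type*} [TopologicalSpace M] [ChartedSpace (EuclideanSpace ℝ (Fin m)) M]
  [IsManifold (𝓡 m) ∞ M]

namespace PseudoRiemannianMetric

/-- A positive smooth function with `μ (Φ P) = λ(Φ) μ(P)` for all homotheties `Φ`. -/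
structure IsGauge [Nonempty M] (g : PseudoRiemannianMetric m M) (hm : 2 ≤ m) (μ : M → ℝ) :
    Prop where
  smooth : ContMDiff (𝓡 m) 𝓘(ℝ, ℝ) ∞ μ
  pos (P : M) : 0 < μ P
  map (Φ : g.homothetyGroup) (P : M) :
    μ ((Φ : Equiv.Perm M) P) = g.homothetyCharacter hm Φ * μ P

variable {g : PseudoRiemannianMetric m M} {hm : 2 ≤ m} {μ : M → ℝ}

theorem homothetyCharacter_pos [Nonempty M] (hm : 2 ≤ m) (Φ : g.homothetyGroup) :
    0 < g.homothetyCharacter hm Φ :=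
  g.homothetyConstant_pos Φ

theorem pullsBackTo_homothetyCharacter [Nonempty M] (hm : 2 ≤ m) (Φ : g.homothetyGroup) :
    g.PullsBackTo Φ (g.homothetyCharacter hm Φ) :=
  g.pullsBackTo_homothetyConstant Φ

/-- Weight `-ℓ` of `F` becomes weight `ℓ` of the quotient `F P₀ / F P`, and the `ℓ`-th root makes it
one. Smoothness holds because the quotient never vanishes. -/
theorem isGauge_muFun [Nonempty M] (hm : 2 ≤ m) {ℓ : ℕ} {F : M → ℝ} (hF : F ∈ g.weylInvariants ℓ)
    (hF0 : ∀ P, F P ≠ 0) (P₀ : M) : g.IsGauge hm (muFun F ℓ P₀) where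
  smooth P := by
    have h1 : ContDiffAt ℝ ∞ (fun t : ℝ => |F P₀ / t| ^ (1 / (ℓ : ℝ))) (F P) := by
      have h2 : F P₀ / F P ≠ 0 := div_ne_zero (hF0 _) (hF0 _)
      exact ((contDiffAt_const.div contDiffAt_id (hF0 P)).abs h2).rpow_const_of_ne (abs_ne_zero.2 h2)
    exact h1.contMDiffAt.comp P (g.contMDiff_weylInvariant hF P)
  pos P := Real.rpow_pos_of_pos (abs_pos.2 (div_ne_zero (hF0 _) (hF0 _))) _
  map Φ P := by
    have hℓ : ℓ ≠ 0 := by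
      rintro rfl
      exact hF0 P₀ (congrFun (weylInvariant_eq_zero_of_order_eq_zero hF) P₀)
    have hc := homothetyCharacter_pos hm Φ
    have h1 := (pullsBackTo_homothetyCharacter hm Φ).weylInvariant hc Φ.2.1 hF P
    set c := g.homothetyCharacter hm Φ
    have h2 : |F P₀ / F ((Φ : Equiv.Perm M) P)| = c ^ ℓ * |F P₀ / F P| := by
      rw [h1, ← abs_of_pos (pow_pos hc ℓ), ← abs_mul, abs_of_pos (pow_pos hc ℓ)]
      have := hF0 ((Φ : Equiv.Perm M) P)
      congr 1
      field_simp
    rw [muFun, muFun, h2, Real.mul_rpow (by positivity) (abs_nonneg _), one_div,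
      Real.pow_rpow_inv_natCast hc.le hℓ]

namespace IsGauge

variable [ConnectedSpace M] {𝓗 : Subgroup g.homothetyGroup}

theorem map_pow (h : g.IsGauge hm μ) (Φ : g.homothetyGroup) (n : ℕ) (P : M) :
    μ (((Φ ^ n : g.homothetyGroup) : Equiv.Perm M) P) = g.homothetyCharacter hm Φ ^ n * μ P := by
  rw [h.map, _root_.map_pow]

theorem eq_of_apply_eq (h : g.IsGauge hm μ) {μ' : M → ℝ} (h' : g.IsGauge hm μ')
    (h_trans : ∀ P Q : M, ∃ Φ ∈ 𝓗, (Φ : Equiv.Perm M) P = Q) {P₀ : M} (h0 : μ P₀ = μ' P₀) :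
    μ = μ' := by
  ext P
  obtain ⟨Φ, -, rfl⟩ := h_trans P₀ P
  rw [h.map, h'.map, h0]

/-- The critical set is invariant under homotheties. If nonempty it is all of `M`, so `μ` is
constant and every character value is 1. -/
theorem mfderiv_ne_zero (h : g.IsGauge hm μ)
    (h_trans : ∀ P Q : M, ∃ Φ ∈ 𝓗, (Φ : Equiv.Perm M) P = Q)
    (h_char : ∃ Φ ∈ 𝓗, g.homothetyCharacter hm Φ ≠ 1) (P : M) :
    mfderiv (𝓡 m) 𝓘(ℝ, ℝ) μ P ≠ 0 := by
  intro h0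
  have hzero : ∀ Q, mfderiv (𝓡 m) 𝓘(ℝ, ℝ) μ Q = 0 := by
    intro Q
    obtain ⟨Φ, -, hΦ⟩ := h_trans Q P
    have hc := (homothetyCharacter_pos hm Φ).ne'
    have hdμ : MDifferentiable (𝓡 m) 𝓘(ℝ, ℝ) μ := h.smooth.mdifferentiable (by simp)
    have h1 := mfderiv_comp Q (hdμ _) (Φ.2.1.mdifferentiable (by simp) Q)
    have h2 : μ ∘ (Φ : Equiv.Perm M) = g.homothetyCharacter hm Φ • μ := by
      ext R
      exact h.map Φ R
    rw [h2, const_smul_mfderiv (hdμ Q)] at h1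
    ext v
    have h3 := congrArg (fun f => f v) h1
    have h4 : mfderiv (𝓡 m) 𝓘(ℝ, ℝ) μ ((Φ : Equiv.Perm M) Q) = 0 := by rw [hΦ]; exact h0
    have h5 : g.homothetyCharacter hm Φ * (show ℝ from mfderiv (𝓡 m) 𝓘(ℝ, ℝ) μ Q v) = 0 := by
      refine h3.trans ?_
      exact congrArg (fun f => f (mfderiv (𝓡 m) (𝓡 m) (Φ : Equiv.Perm M) Q v)) h4
    exact (mul_eq_zero.1 h5).resolve_left hc
  obtain ⟨Φ, -, hΦ⟩ := h_char
  have h1 := h.map Φ P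
  rw [eq_of_mfderiv_eq_zero h.smooth hzero _ P] at h1
  exact hΦ (mul_right_cancel₀ (h.pos P).ne' (by rw [one_mul, ← h1]))

theorem isSmoothSubmanifold (h : g.IsGauge hm μ)
    (h_trans : ∀ P Q : M, ∃ Φ ∈ 𝓗, (Φ : Equiv.Perm M) P = Q)
    (h_char : ∃ Φ ∈ 𝓗, g.homothetyCharacter hm Φ ≠ 1) (c : ℝ) :
    IsSmoothSubmanifold m 1 {P | μ P = c} :=
  h.smooth.isSmoothSubmanifold_level (by omega) fun p _ => h.mfderiv_ne_zero h_trans h_char p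

/-- An element of `𝓗` taking `P` to `Q` multiplies `μ` by its character, so it preserves the level
exactly when the character is 1. -/
theorem orbit_eq (h : g.IsGauge hm μ)
    (h_trans : ∀ P Q : M, ∃ Φ ∈ 𝓗, (Φ : Equiv.Perm M) P = Q) (P : M) :
    {Q | ∃ Φ ∈ 𝓗 ⊓ (g.homothetyCharacter hm).ker, (Φ : Equiv.Perm M) P = Q}
      = {Q | μ Q = μ P} := by
  ext Q
  constructor
  · rintro ⟨Φ, ⟨-, hΦ⟩, rfl⟩
    have h1 : g.homothetyCharacter hm Φ = 1 := hΦ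
    change μ _ = _
    rw [h.map, h1, one_mul]
  · intro hQ
    obtain ⟨Φ, hΦ, rfl⟩ := h_trans P Q
    refine ⟨Φ, ⟨hΦ, ?_⟩, rfl⟩
    have h1 := (h.map Φ P).symm.trans hQ
    exact mul_right_cancel₀ (h.pos P).ne' (h1.trans (one_mul _).symm)

/-- Powers of a homothety with character greater than 1, and their inverses, make `μ` arbitrarily
large and small; the intermediate value theorem does the rest. -/
theorem exists_eq (h : g.IsGauge hm μ) (h_char : ∃ Φ ∈ 𝓗, g.homothetyCharacter hm Φ ≠ 1) {c : ℝ}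
    (hc : 0 < c) : ∃ P, μ P = c := by
  obtain ⟨Φ, hΦ⟩ : ∃ Φ : g.homothetyGroup, 1 < g.homothetyCharacter hm Φ := by
    obtain ⟨Φ, -, hΦ⟩ := h_char
    rcases hΦ.lt_or_gt with h1 | h1
    · refine ⟨Φ⁻¹, ?_⟩
      have h2 : g.homothetyCharacter hm Φ⁻¹ * g.homothetyCharacter hm Φ = 1 := by
        rw [← map_mul, inv_mul_cancel, map_one]
      have := homothetyCharacter_pos hm Φ⁻¹
      nlinarith
    · exact ⟨Φ, h1⟩
  obtain ⟨P⟩ := (inferInstance : Nonempty M)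
  have hP := h.pos P
  refine mem_range_of_exists_le_of_exists_ge h.smooth.continuous ?_ ?_
  · obtain ⟨n, hn⟩ := pow_unbounded_of_one_lt (μ P / c) hΦ
    refine ⟨(((Φ ^ n)⁻¹ : g.homothetyGroup) : Equiv.Perm M) P, ?_⟩
    have h2 := h.map_pow Φ n ((((Φ ^ n)⁻¹ : g.homothetyGroup) : Equiv.Perm M) P)
    have h3 : ((Φ ^ n : g.homothetyGroup) : Equiv.Perm M)
        ((((Φ ^ n)⁻¹ : g.homothetyGroup) : Equiv.Perm M) P) = P :=
      ((Φ ^ n : g.homothetyGroup) : Equiv.Perm M).apply_symm_apply P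
    rw [h3] at h2
    rw [div_lt_iff₀ hc, h2] at hn
    exact (lt_of_mul_lt_mul_left hn (by positivity)).le
  · obtain ⟨n, hn⟩ := pow_unbounded_of_one_lt (c / μ P) hΦ
    refine ⟨((Φ ^ n : g.homothetyGroup) : Equiv.Perm M) P, ?_⟩
    rw [h.map_pow, ← div_le_iff₀ hP]
    exact hn.le

theorem exists_character_eq (h : g.IsGauge hm μ)
    (h_trans : ∀ P Q : M, ∃ Φ ∈ 𝓗, (Φ : Equiv.Perm M) P = Q)
    (h_char : ∃ Φ ∈ 𝓗, g.homothetyCharacter hm Φ ≠ 1) {c : ℝ} (hc : 0 < c) :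
    ∃ Φ ∈ 𝓗, g.homothetyCharacter hm Φ = c := by
  obtain ⟨P⟩ := (inferInstance : Nonempty M)
  obtain ⟨Q, hQ⟩ := h.exists_eq h_char (mul_pos hc (h.pos P))
  obtain ⟨Φ, hΦ, rfl⟩ := h_trans P Q
  rw [h.map] at hQ
  exact ⟨Φ, hΦ, mul_right_cancel₀ (h.pos P).ne' hQ⟩

end IsGauge

/-! ### The distance between level sets -/

theorem setEDist_le {A B : Set M} {p q : M} (hp : p ∈ A) (hq : q ∈ B) :
    g.setEDist A B ≤ g.edist p q :=
  (iInf₂_le p hp).trans (iInf₂_le q hq)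

theorem exists_edist_lt_of_setEDist_lt {A B : Set M} {r : ℝ≥0∞} (h : g.setEDist A B < r) :
    ∃ p ∈ A, ∃ q ∈ B, g.edist p q < r := by
  simpa only [setEDist, iInf_lt_iff, exists_prop] using h

theorem IsRiemannian.edist_homothety_le [Nonempty M] (hg : g.IsRiemannian) (hm : 2 ≤ m)
    (Φ : g.homothetyGroup) (p q : M) :
    g.edist ((Φ : Equiv.Perm M) p) ((Φ : Equiv.Perm M) q)
      ≤ ENNReal.ofReal (g.homothetyCharacter hm Φ) * g.edist p q :=
  (pullsBackTo_homothetyCharacter hm Φ).edist_le hg (homothetyCharacter_pos hm Φ) Φ.2.1 p q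

theorem IsRiemannian.setEDist_comm (hg : g.IsRiemannian) (A B : Set M) :
    g.setEDist A B = g.setEDist B A := by
  have h : ∀ A B : Set M, g.setEDist A B ≤ g.setEDist B A := fun A B =>
    le_iInf₂ fun p hp => le_iInf₂ fun q hq => (setEDist_le hq hp).trans_eq (hg.edist_comm q p)
  exact le_antisymm (h A B) (h B A)

namespace IsGauge

variable [ConnectedSpace M] {𝓗 : Subgroup g.homothetyGroup}

/-- Distances between sets violate the triangle inequality in general. Here an isometry moves the
start `q'` of the second path to the end `q` of the first within the middle level. -/
theorem setEDist_triangle (h : g.IsGauge hm μ) (hg : g.IsRiemannian)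
    (h_trans : ∀ P Q : M, ∃ Φ ∈ 𝓗, (Φ : Equiv.Perm M) P = Q) (c d e : ℝ) :
    g.setEDist {P | μ P = c} {P | μ P = e}
      ≤ g.setEDist {P | μ P = c} {P | μ P = d} + g.setEDist {P | μ P = d} {P | μ P = e} := by
  refine le_of_forall_gt fun r hr => ?_
  obtain ⟨s, hs, t, ht, hst⟩ := ENNReal.exists_add_lt_of_add_lt hr
  obtain ⟨p, hp, q, hq, hpq⟩ := exists_edist_lt_of_setEDist_lt hs
  obtain ⟨q', hq', z, hz, hqz⟩ := exists_edist_lt_of_setEDist_lt ht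
  have h1 := h.orbit_eq h_trans q'
  have hqq' : q ∈ {Q | μ Q = μ q'} := hq.trans hq'.symm
  rw [← h1] at hqq'
  obtain ⟨Φ, ⟨-, hΦ⟩, rfl⟩ := hqq'
  have hΦ1 : g.homothetyCharacter hm Φ = 1 := hΦ
  have hΦz : (Φ : Equiv.Perm M) z ∈ {P | μ P = e} := by
    change μ _ = e
    rw [h.map, hΦ1, one_mul]
    exact hz
  have h2 := hg.edist_homothety_le hm Φ q' z
  rw [hΦ1, ENNReal.ofReal_one, one_mul] at h2
  exact ((setEDist_le hp hΦz).trans (hg.edist_triangle _ _ _)).trans_lt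
    ((ENNReal.add_lt_add hpq (h2.trans_lt hqz)).trans hst)

/-- A nearly shortest curve between the outer levels must cross the middle one, where it is cut in
two. -/
theorem setEDist_add (h : g.IsGauge hm μ) (hg : g.IsRiemannian)
    (h_trans : ∀ P Q : M, ∃ Φ ∈ 𝓗, (Φ : Equiv.Perm M) P = Q) {c d e : ℝ} (hcd : c ≤ d)
    (hde : d ≤ e) :
    g.setEDist {P | μ P = c} {P | μ P = d} + g.setEDist {P | μ P = d} {P | μ P = e}
      = g.setEDist {P | μ P = c} {P | μ P = e} := by
  refine le_antisymm (le_of_forall_gt fun r hr => ?_) (h.setEDist_triangle hg h_trans c d e)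
  obtain ⟨p, hp, q, hq, hpq⟩ := exists_edist_lt_of_setEDist_lt hr
  obtain ⟨z, hz, hlt⟩ := hg.exists_edist_add_edist_lt h.smooth.continuous hpq (d := d)
    (le_of_eq_of_le hp hcd) (le_of_le_of_eq hde hq.symm)
  have h1 : g.setEDist {P | μ P = c} {P | μ P = d} ≤ g.edist p z := setEDist_le hp hz
  have h2 : g.setEDist {P | μ P = d} {P | μ P = e} ≤ g.edist z q := setEDist_le hz hq
  exact (add_le_add h1 h2).trans_lt hlt

theorem setEDist_smul_le (h : g.IsGauge hm μ) (hg : g.IsRiemannian) (Φ : g.homothetyGroup)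
    (c d : ℝ) :
    g.setEDist {P | μ P = g.homothetyCharacter hm Φ * c} {P | μ P = g.homothetyCharacter hm Φ * d}
      ≤ ENNReal.ofReal (g.homothetyCharacter hm Φ) * g.setEDist {P | μ P = c} {P | μ P = d} := by
  have h0 : ENNReal.ofReal (g.homothetyCharacter hm Φ) ≠ 0 := by
    simpa using homothetyCharacter_pos hm Φ
  rw [mul_comm (ENNReal.ofReal _), ← ENNReal.div_le_iff_le_mul (.inl h0)
    (.inl ENNReal.ofReal_ne_top)]
  refine le_iInf₂ fun p hp => le_iInf₂ fun q hq => ?_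
  rw [ENNReal.div_le_iff_le_mul (.inl h0) (.inl ENNReal.ofReal_ne_top),
    mul_comm (g.edist p q)]
  refine (setEDist_le (p := (Φ : Equiv.Perm M) p) (q := (Φ : Equiv.Perm M) q) ?_ ?_).trans
    (hg.edist_homothety_le hm Φ p q)
  · exact (h.map Φ p).trans (congrArg _ hp)
  · exact (h.map Φ q).trans (congrArg _ hq)

theorem setEDist_smul (h : g.IsGauge hm μ) (hg : g.IsRiemannian)
    (h_trans : ∀ P Q : M, ∃ Φ ∈ 𝓗, (Φ : Equiv.Perm M) P = Q)
    (h_char : ∃ Φ ∈ 𝓗, g.homothetyCharacter hm Φ ≠ 1) {s : ℝ} (hs : 0 < s) (c d : ℝ) :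
    g.setEDist {P | μ P = s * c} {P | μ P = s * d}
      = ENNReal.ofReal s * g.setEDist {P | μ P = c} {P | μ P = d} := by
  have key : ∀ s : ℝ, 0 < s → ∀ c d, g.setEDist {P | μ P = s * c} {P | μ P = s * d}
      ≤ ENNReal.ofReal s * g.setEDist {P | μ P = c} {P | μ P = d} := by
    intro s hs c d
    obtain ⟨Φ, -, rfl⟩ := h.exists_character_eq h_trans h_char hs
    exact h.setEDist_smul_le hg Φ c d
  refine le_antisymm (key s hs c d) ?_
  -- The reverse inequality is the same estimate for the inverse scaling.
  have h1 := key s⁻¹ (inv_pos.2 hs) (s * c) (s * d)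
  rw [inv_mul_cancel_left₀ hs.ne', inv_mul_cancel_left₀ hs.ne'] at h1
  calc ENNReal.ofReal s * g.setEDist {P | μ P = c} {P | μ P = d}
      ≤ ENNReal.ofReal s * (ENNReal.ofReal s⁻¹ * _) := by gcongr
    _ = _ := by
      rw [← mul_assoc, ← ENNReal.ofReal_mul hs.le, mul_inv_cancel₀ hs.ne', ENNReal.ofReal_one,
        one_mul]

theorem setEDist_ne_top (h : g.IsGauge hm μ) (hg : g.IsRiemannian)
    (h_char : ∃ Φ ∈ 𝓗, g.homothetyCharacter hm Φ ≠ 1) {c d : ℝ} (hc : 0 < c) (hd : 0 < d) :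
    g.setEDist {P | μ P = c} {P | μ P = d} ≠ ⊤ := by
  obtain ⟨p, hp⟩ := h.exists_eq h_char hc
  obtain ⟨q, hq⟩ := h.exists_eq h_char hd
  exact ne_top_of_le_ne_top (hg.edist_ne_top p q) (setEDist_le hp hq)

/-- Disjoint closed sets may be at distance zero. Here isometries move the start of any short path
to one fixed `p₀`, and a whole ball around `p₀` lies in `μ < d`. -/
theorem setEDist_pos [T2Space M] (h : g.IsGauge hm μ) (hg : g.IsRiemannian)
    (h_trans : ∀ P Q : M, ∃ Φ ∈ 𝓗, (Φ : Equiv.Perm M) P = Q) {c d : ℝ} (hcd : c < d) :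
    0 < g.setEDist {P | μ P = c} {P | μ P = d} := by
  by_contra! h0
  -- A finite infimum shows that the level is nonempty.
  obtain ⟨p₀, hp₀, -⟩ := exists_edist_lt_of_setEDist_lt (h0.trans_lt one_pos)
  have hs : {P | μ P < d} ∈ 𝓝 p₀ := (isOpen_lt h.smooth.continuous continuous_const).mem_nhds
    (lt_of_eq_of_lt hp₀ hcd)
  obtain ⟨ε, hε, hsub⟩ := hg.exists_edist_lt_subset hs
  obtain ⟨p, hp, q, hq, hpq⟩ := exists_edist_lt_of_setEDist_lt (h0.trans_lt hε)
  have hpp : p₀ ∈ {Q | μ Q = μ p} := hp₀.trans hp.symm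
  rw [← h.orbit_eq h_trans p] at hpp
  obtain ⟨Φ, ⟨-, hΦ⟩, rfl⟩ := hpp
  have hΦ1 : g.homothetyCharacter hm Φ = 1 := hΦ
  have h2 := hg.edist_homothety_le hm Φ p q
  rw [hΦ1, ENNReal.ofReal_one, one_mul] at h2
  have h3 : μ ((Φ : Equiv.Perm M) q) < d := hsub _ (h2.trans_lt hpq)
  rw [h.map, hΦ1, one_mul] at h3
  exact h3.ne hq

/-- The distance between level sets is proportional to the difference of the levels. -/
theorem exists_setEDist_eq [T2Space M] (h : g.IsGauge hm μ) (hg : g.IsRiemannian)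
    (h_trans : ∀ P Q : M, ∃ Φ ∈ 𝓗, (Φ : Equiv.Perm M) P = Q)
    (h_char : ∃ Φ ∈ 𝓗, g.homothetyCharacter hm Φ ≠ 1) :
    ∃ κ : ℝ, 0 < κ ∧ ∀ c d : ℝ, 0 < c → 0 < d →
      g.setEDist {P | μ P = c} {P | μ P = d} = ENNReal.ofReal (κ * |c - d|) := by
  set D : ℝ → ℝ≥0∞ := fun x => g.setEDist {P | μ P = 1} {P | μ P = x} with hD
  have hD_top : ∀ x, 0 < x → D x ≠ ⊤ := fun x hx => h.setEDist_ne_top hg h_char one_pos hx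
  have hD_smul : ∀ c x, 0 < c →
      g.setEDist {P | μ P = c} {P | μ P = c * x} = ENNReal.ofReal c * D x := fun c x hc => by
    simpa using h.setEDist_smul hg h_trans h_char hc 1 x
  have hD_mul : ∀ x y, 1 ≤ x → 1 ≤ y → (D (x * y)).toReal = (D x).toReal + x * (D y).toReal := by
    intro x y hx hy
    have hx0 : 0 < x := by linarith
    have e : D (x * y) = D x + ENNReal.ofReal x * D y := by
      rw [← hD_smul x y hx0]
      exact (h.setEDist_add hg h_trans hx (le_mul_of_one_le_right hx0.le hy)).symm
    rw [e, ENNReal.toReal_add (hD_top x hx0)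
        (ENNReal.mul_ne_top ENNReal.ofReal_ne_top (hD_top y (by linarith))),
      ENNReal.toReal_mul, ENNReal.toReal_ofReal hx0.le]
  -- Splitting `D (2x)` at level `x` and at level `2` gives `D x + x D 2 = D 2 + 2 D x`. Hence `κ =
  -- D 2`.
  have hκ : ∀ x, 1 ≤ x → (D x).toReal = (D 2).toReal * (x - 1) := by
    intro x hx
    have h1 := hD_mul x 2 hx one_le_two
    have h2 := hD_mul 2 x one_le_two hx
    rw [mul_comm] at h1
    linarith
  have hle : ∀ c d : ℝ, 0 < c → c ≤ d →
      g.setEDist {P | μ P = c} {P | μ P = d} = ENNReal.ofReal ((D 2).toReal * |c - d|) := by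
    intro c d hc hcd
    have h1 := hD_smul c (d / c) hc
    rw [mul_div_cancel₀ d hc.ne'] at h1
    have hdc : 1 ≤ d / c := (one_le_div hc).2 hcd
    rw [h1, ← ENNReal.ofReal_toReal (hD_top (d / c) (by linarith)), hκ _ hdc,
      ← ENNReal.ofReal_mul hc.le, abs_sub_comm, abs_of_nonneg (sub_nonneg.2 hcd)]
    congr 1
    field_simp
  refine ⟨(D 2).toReal, ENNReal.toReal_pos (h.setEDist_pos hg h_trans one_lt_two).ne'
    (hD_top 2 two_pos), fun c d hc hd => ?_⟩
  rcases le_total c d with hcd | hcd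
  · exact hle c d hc hcd
  · rw [hg.setEDist_comm, hle d c hd hcd, abs_sub_comm]

/-- The orbit of a point under powers of a contraction by 1/2 is Cauchy. A limit `q` would have `μ`
bounded below near it, while `μ → 0` along the orbit. -/
theorem not_isComplete [T2Space M] (h : g.IsGauge hm μ) (hg : g.IsRiemannian)
    (h_trans : ∀ P Q : M, ∃ Φ ∈ 𝓗, (Φ : Equiv.Perm M) P = Q)
    (h_char : ∃ Φ ∈ 𝓗, g.homothetyCharacter hm Φ ≠ 1) : ¬ g.IsComplete := by
  intro hcomp
  obtain ⟨Φ, -, hΦ⟩ := h.exists_character_eq h_trans h_char (c := 1 / 2) (by norm_num)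
  obtain ⟨P⟩ := (inferInstance : Nonempty M)
  set u : ℕ → M := fun n => ((Φ ^ n : g.homothetyGroup) : Equiv.Perm M) P with hu
  have hu_add : ∀ N n, u (N + n) = ((Φ ^ N : g.homothetyGroup) : Equiv.Perm M) (u n) := by
    intro N n
    simp only [hu, pow_add]
    rfl
  set a : ℝ≥0∞ := ENNReal.ofReal (1 / 2) with ha
  have ha2 : a * 2 = 1 := by
    rw [ha, ← ENNReal.ofReal_ofNat 2, ← ENNReal.ofReal_mul (by norm_num)]
    norm_num
  have hpow : ∀ N x y, g.edist (((Φ ^ N : g.homothetyGroup) : Equiv.Perm M) x)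
      (((Φ ^ N : g.homothetyGroup) : Equiv.Perm M) y) ≤ a ^ N * g.edist x y := by
    intro N x y
    have h1 := hg.edist_homothety_le hm (Φ ^ N) x y
    rwa [_root_.map_pow, hΦ, ENNReal.ofReal_pow (by norm_num)] at h1
  set C := g.edist P (u 1) with hC
  have hCtop : C ≠ ⊤ := hg.edist_ne_top _ _
  -- `2C` is the fixed point of the recursion `x ↦ C + x / 2`.
  have hbound : ∀ n, g.edist P (u n) ≤ 2 * C := by
    intro n
    induction n with
    | zero =>
      have : u 0 = P := rfl
      rw [this, hg.edist_self]
      exact zero_le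
    | succ n ih =>
      calc g.edist P (u (n + 1)) ≤ C + g.edist (u 1) (u (n + 1)) := hg.edist_triangle _ _ _
        _ ≤ C + a * (2 * C) := by
          gcongr
          have h1 := hpow 1 P (u n)
          rw [← hu_add, add_comm, pow_one a] at h1
          exact h1.trans (by gcongr)
        _ = 2 * C := by rw [← mul_assoc, ha2, one_mul, two_mul]
  obtain ⟨q, hq⟩ := hcomp u fun ε hε => by
    have h1 : Tendsto (fun N : ℕ => a ^ N * (2 * C + 2 * C)) atTop (𝓝 (0 * (2 * C + 2 * C))) := by
      refine ENNReal.Tendsto.mul_const (ENNReal.tendsto_pow_atTop_nhds_zero_of_lt_one ?_) (.inr ?_)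
      · rw [ha, ENNReal.ofReal_lt_one]
        norm_num
      · exact ENNReal.add_ne_top.2 ⟨ENNReal.mul_ne_top (by simp) hCtop,
          ENNReal.mul_ne_top (by simp) hCtop⟩
    rw [zero_mul] at h1
    obtain ⟨N, hN⟩ := (h1.eventually (gt_mem_nhds hε)).exists
    refine ⟨N, fun i hi j hj => lt_of_le_of_lt ?_ hN⟩
    obtain ⟨i, rfl⟩ := Nat.exists_eq_add_of_le hi
    obtain ⟨j, rfl⟩ := Nat.exists_eq_add_of_le hj
    rw [hu_add, hu_add]
    refine (hpow N _ _).trans ?_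
    gcongr
    refine (hg.edist_triangle _ P _).trans (add_le_add ?_ (hbound j))
    rw [hg.edist_comm]
    exact hbound i
  have hs : {Q | μ q / 2 < μ Q} ∈ 𝓝 q := (isOpen_lt continuous_const h.smooth.continuous).mem_nhds
    (half_lt_self (h.pos q))
  obtain ⟨ε, hε, hsub⟩ := hg.exists_edist_lt_subset hs
  have h1 : Tendsto (fun n => μ (u n)) atTop (𝓝 (0 * μ P)) := by
    have h2 : (fun n => μ (u n)) = fun n : ℕ => (1 / 2 : ℝ) ^ n * μ P := by
      ext n
      rw [← hΦ]
      exact h.map_pow Φ n P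
    rw [h2]
    exact (tendsto_pow_atTop_nhds_zero_of_lt_one (by norm_num) (by norm_num)).mul_const _
  rw [zero_mul] at h1
  obtain ⟨n, hn1, hn2⟩ := ((h1.eventually (gt_mem_nhds (half_pos (h.pos q)))).and
    (hq.eventually (gt_mem_nhds hε))).exists
  rw [hg.edist_comm] at hn2
  exact lt_asymm hn1 (hsub _ hn2)

end IsGauge

end PseudoRiemannianMetric

end Gauge

/-! ### Assembly of the theorem. -/

theorem theorem1p6 {m : ℕ} (hm : 2 ≤ m) {M : Type*} [TopologicalSpace M]
    [ChartedSpace (EuclideanSpace ℝ (Fin m)) M] [IsManifold (𝓡 m) ∞ M]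
    [T2Space M] [SecondCountableTopology M] [ConnectedSpace M]
    (g : PseudoRiemannianMetric m M) (P₀ : M)
    (𝓗 : Subgroup g.homothetyGroup)
    (h_trans : ∀ P Q : M, ∃ Φ ∈ 𝓗, (Φ : Equiv.Perm M) P = Q)
    (h_char : ∃ Φ ∈ 𝓗, g.homothetyCharacter hm Φ ≠ 1)
    (h_vsi : ¬ g.IsVSI) :
    -- the level sets
    (∀ (ℓ : ℕ), ∀ F ∈ g.weylInvariants ℓ, (∀ P, F P ≠ 0) →
      (∀ c : ℝ, 0 < c →
        (levelSet F ℓ P₀ c).Nonempty ∧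
        IsSmoothSubmanifold m 1 (levelSet F ℓ P₀ c) ∧
        ∀ P ∈ levelSet F ℓ P₀ c,
          {Q | ∃ Φ ∈ 𝓗 ⊓ (g.homothetyCharacter hm).ker, (Φ : Equiv.Perm M) P = Q}
            = levelSet F ℓ P₀ c) ∧
      (∀ (ℓ' : ℕ), ∀ F' ∈ g.weylInvariants ℓ', (∀ P, F' P ≠ 0) →
        ∀ c : ℝ, levelSet F ℓ P₀ c = levelSet F' ℓ' P₀ c)) ∧
    -- cohomogeneity one: the orbits of the full isometry group are hypersurfaces
    (∀ P : M, IsSmoothSubmanifold m 1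
      {Q | ∃ Φ ∈ (g.homothetyCharacter hm).ker, (Φ : Equiv.Perm M) P = Q}) ∧
    -- the Riemannian case
    (g.IsRiemannian →
      (∃ κ : ℝ, 0 < κ ∧ ∀ (ℓ : ℕ), ∀ F ∈ g.weylInvariants ℓ, (∀ P, F P ≠ 0) →
        ∀ c d : ℝ, 0 < c → 0 < d →
          g.setEDist (levelSet F ℓ P₀ c) (levelSet F ℓ P₀ d) = ENNReal.ofReal (κ * |c - d|)) ∧
      ¬ g.IsComplete) := by
  have h_eq : ∀ (ℓ : ℕ), ∀ F ∈ g.weylInvariants ℓ, (∀ P, F P ≠ 0) → ∀ (ℓ' : ℕ),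
      ∀ F' ∈ g.weylInvariants ℓ', (∀ P, F' P ≠ 0) → muFun F ℓ P₀ = muFun F' ℓ' P₀ :=
    fun ℓ F hF hF0 ℓ' F' hF' hF0' =>
      (PseudoRiemannianMetric.isGauge_muFun hm hF hF0 P₀).eq_of_apply_eq
        (PseudoRiemannianMetric.isGauge_muFun hm hF' hF0' P₀) h_trans (by
          rw [PseudoRiemannianMetric.muFun_self (hF0 P₀),
            PseudoRiemannianMetric.muFun_self (hF0' P₀)])
  -- By weight and transitivity, an invariant that is nonzero at one point vanishes nowhere.
  obtain ⟨ℓ₀, F₀, hF₀, hF₀0⟩ : ∃ ℓ, ∃ F ∈ g.weylInvariants ℓ, ∀ P, F P ≠ 0 := by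
    simp only [PseudoRiemannianMetric.IsVSI, not_forall] at h_vsi
    obtain ⟨ℓ, F, hF, p, hp⟩ := h_vsi
    refine ⟨ℓ, F, hF, fun P hP => hp ?_⟩
    obtain ⟨Φ, -, rfl⟩ := h_trans p P
    rw [(PseudoRiemannianMetric.pullsBackTo_homothetyCharacter hm Φ).weylInvariant
      (PseudoRiemannianMetric.homothetyCharacter_pos hm Φ) Φ.2.1 hF p, hP, mul_zero]
  have h₀ := PseudoRiemannianMetric.isGauge_muFun hm hF₀ hF₀0 P₀
  refine ⟨fun ℓ F hF hF0 => ⟨fun c hc => ?_, fun ℓ' F' hF' hF0' c => ?_⟩, fun P => ?_,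
    fun hg => ⟨?_, h₀.not_isComplete hg h_trans h_char⟩⟩
  · have h := PseudoRiemannianMetric.isGauge_muFun hm hF hF0 P₀
    refine ⟨h.exists_eq h_char hc, h.isSmoothSubmanifold h_trans h_char c, fun P hP => ?_⟩
    rw [h.orbit_eq h_trans P, show muFun F ℓ P₀ P = c from hP]
    rfl
  · rw [levelSet, levelSet, h_eq ℓ F hF hF0 ℓ' F' hF' hF0']
  -- The full homothety group is transitive as well; its isometries therefore have the same level
  -- sets as orbits.
  · have h1 := h₀.orbit_eq (𝓗 := ⊤) (fun P Q => (h_trans P Q).imp fun Φ hΦ => ⟨trivial, hΦ.2⟩) P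
    rw [top_inf_eq] at h1
    rw [h1]
    exact h₀.isSmoothSubmanifold h_trans h_char _
  -- One `κ` serves every invariant because all the functions `muFun` coincide.
  · obtain ⟨κ, hκ, hdist⟩ := h₀.exists_setEDist_eq hg h_trans h_char
    refine ⟨κ, hκ, fun ℓ F hF hF0 c d hc hd => ?_⟩
    rw [levelSet, levelSet, h_eq ℓ F hF hF0 ℓ₀ F₀ hF₀ hF₀0]
    exact hdist c d hc hd
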